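/- Let $S$ be an inverse semigroup with its natural partial order; an element is called zero if it is the least element. Joins and meets refer to the natural partial order. Elements $s,t$ are compatible if $s^{-1}t$ and $st^{-1}$ are idempotent. An inverse semigroup is distributive if every finite compatible subset (including $\emptyset$) has a join and multiplication distributes, on both sides, over the finite joins that exist; a morphism of distributive inverse semigroups is a semigroup homomorphism preserving joins of finite compatible subsets. For $a\in S$ let $\mathcal{T}(a)$ be the set of all finite subsets $X$ of $\{x\in S: x\le a\}$ such that for every non-zero $x\le a$ there are $b\in X$ and a non-zero $y$ with $y\le x$ and $y\le b$. A semigroup homomorphism $\theta\colon S\to T$ to a distributive inverse semigroup is tight if $\theta(a)=\bigvee_{x\in X}\theta(x)$ for all $a\in S$ and $X\in\mathcal{T}(a)$. A (proper) filter is a non-empty, down-directed, upward closed subset not containing zero. For a filter $A$ put $A^{-1}=\{a^{-1}:a\in A\}$, $\mathbf{d}(A)=(A^{-1}A)^{\uparrow}$ and $\mathbf{r}(A)=(AA^{-1})^{\uparrow}$, where $X^{\uparrow}$ is the upward closure of $X$; when $\mathbf{d}(A)=\mathbf{r}(B)$ put $A\cdot B=(AB)^{\uparrow}$. A filter $A$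 of $S$ is tight if $a\in A$ and $X\in\mathcal{T}(a)$ imply $X\cap A\neq\emptyset$; a filter $P$ of a distributive inverse semigroup is prime if $a\vee b\in P$ implies $a\in P$ or $b\in P$. Let $\mathsf{G}_{\mathcal{T}}(S)$ be the groupoid of tight filters of $S$, and $\mathsf{G}_P(D)$ the groupoid of prime filters of a distributive inverse semigroup $D$, each with the inversion $A\mapsto A^{-1}$, the partial product above, and the topology generated by the sets of all filters of the respective kind that contain a given element. **Theorem 4.30.** For every inverse semigroup $S$ there are a distributive inverse semigroup $\mathsf{D}_t(S)$ and a tight map $\delta\colon S\to\mathsf{D}_t(S)$ such that: 1. for every tight map $\theta\colon S\to T$ to a distributive inverse semigroup $T$ there is a unique morphism of distributive inverse semigroups $\bar\theta\colon\mathsf{D}_t(S)\to T$ with $\bar\theta\,\delta=\theta$; 2. $\mathsf{G}_{\mathcal{T}}(S)$ and $\mathsf{G}_P(\mathsf{D}_t(S))$ are étale groupoids (topological groupoids whose domain map $x\mapsto x^{-1}x$, as a map to the space of identities, is a local homeomorphism), and they are homeomorphic, that is, there is an isomorphism of groupoids between them that is a homeomorphism; 3. if $S$ satisfies the weak meet condition,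 that is, for all $a,b\in S$ the order ideal $\{x\in S: x\le a \text{ and } x\le b\}$ is generated by a finite set, then any two elements of $\mathsf{D}_t(S)$ have a meet. -/

import Mathlib

open scoped Pointwise

universe u v

namespace InvSem

/-! ### Inverse semigroups and the natural partial order -/

/-- An inverse semigroup: every element `a` has a unique generalized inverse `a⁻¹`.
No zero element is assumed. -/
class InverseSemigroup (S : Type u) extends Semigroup S, Inv S where
  mul_inv_mul : ∀ a : S, a * a⁻¹ * a = a
  inv_mul_inv : ∀ a : S, a⁻¹ * a * a⁻¹ = a⁻¹
  inv_unique : ∀ a b : S, a * b * a = a → b * a * b = b → b = a⁻¹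

section Basic

variable {S : Type u} [InverseSemigroup S]

theorem mul_inv_mul (a : S) : a * (a⁻¹ * a) = a := by
  rw [← mul_assoc]; exact InverseSemigroup.mul_inv_mul a

theorem inv_mul_inv (a : S) : a⁻¹ * (a * a⁻¹) = a⁻¹ := by
  rw [← mul_assoc]; exact InverseSemigroup.inv_mul_inv a

theorem eq_inv {a b : S} (h1 : a * (b * a) = a) (h2 : b * (a * b) = b) : b = a⁻¹ :=
  InverseSemigroup.inv_unique a b (by rw [mul_assoc, h1]) (by rw [mul_assoc, h2])

theorem invinv (a : S) : a⁻¹⁻¹ = a := (eq_inv (inv_mul_inv a) (mul_inv_mul a)).symm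

theorem idem_inv {e : S} (he : e * e = e) : e⁻¹ = e := by
  refine (eq_inv ?_ ?_).symm <;> rw [he, he]

/-- The product of two idempotents is idempotent. -/
theorem idem_mul {e f : S} (he : e * e = e) (hf : f * f = f) : e * f * (e * f) = e * f := by
  have ke : ∀ t : S, e * (e * t) = e * t := fun t => by rw [← mul_assoc, he]
  have kf : ∀ t : S, f * (f * t) = f * t := fun t => by rw [← mul_assoc, hf]
  set x := (e * f)⁻¹ with hx
  have h1 : e * (f * (x * (e * f))) = e * f := by
    have := mul_inv_mul (e * f); simpa only [← hx, mul_assoc] using this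
  have h2 : x * (e * (f * x)) = x := by
    have := inv_mul_inv (e * f); simpa only [← hx, mul_assoc] using this
  have h2' : ∀ t : S, x * (e * (f * (x * t))) = x * t := fun t => by
    have := congrArg (· * t) h2; simpa only [mul_assoc] using this
  have h3 : f * (x * e) = x := by
    rw [hx]
    refine eq_inv ?_ ?_ <;> rw [← hx]
    · simp only [mul_assoc, ke, kf, h1]
    · simp only [mul_assoc, ke, kf, h2']
  have hxi : x * x = x := by
    calc x * x = f * (x * e) * (f * (x * e)) := by rw [h3]
      _ = f * (x * e) := by simp only [mul_assoc, h2']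
      _ = x := h3
  have h4 : e * f = x := by
    rw [← invinv (e * f), ← hx, idem_inv hxi]
  rw [h4, hxi]

/-- Idempotents commute. -/
theorem idem_comm {e f : S} (he : e * e = e) (hf : f * f = f) : e * f = f * e := by
  have ke : ∀ t : S, e * (e * t) = e * t := fun t => by rw [← mul_assoc, he]
  have kf : ∀ t : S, f * (f * t) = f * t := fun t => by rw [← mul_assoc, hf]
  have h1 := idem_mul he hf
  have h2 := idem_mul hf he
  have h3 : f * e = (e * f)⁻¹ := by
    refine eq_inv ?_ ?_
    · simp only [mul_assoc, ke, kf] at h1 ⊢; exact h1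
    · simp only [mul_assoc, ke, kf] at h2 ⊢; exact h2
  rw [h3, idem_inv h1]

theorem idem_dom (a : S) : a⁻¹ * a * (a⁻¹ * a) = a⁻¹ * a := by
  rw [mul_assoc, mul_inv_mul]

theorem idem_cod (a : S) : a * a⁻¹ * (a * a⁻¹) = a * a⁻¹ := by
  rw [mul_assoc, inv_mul_inv]

theorem mul_inv_rev' (a b : S) : (a * b)⁻¹ = b⁻¹ * a⁻¹ := by
  have h := idem_comm (idem_dom a) (idem_cod b)
  refine (eq_inv ?_ ?_).symm
  · calc a * b * (b⁻¹ * a⁻¹ * (a * b)) = a * (b * b⁻¹ * (a⁻¹ * a)) * b := by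
          simp only [mul_assoc]
      _ = a * (a⁻¹ * a) * (b * (b⁻¹ * b)) := by rw [← h]; simp only [mul_assoc]
      _ = a * b := by rw [mul_inv_mul, mul_inv_mul]
  · calc b⁻¹ * a⁻¹ * (a * b * (b⁻¹ * a⁻¹)) = b⁻¹ * (a⁻¹ * a * (b * b⁻¹)) * a⁻¹ := by
          simp only [mul_assoc]
      _ = b⁻¹ * (b * b⁻¹) * (a⁻¹ * (a * a⁻¹)) := by rw [h]; simp only [mul_assoc]
      _ = b⁻¹ * a⁻¹ := by rw [inv_mul_inv, inv_mul_inv]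

/-- An idempotent can be moved from the left to the right of an element. -/
theorem idem_slide {e : S} (he : e * e = e) (b : S) : e * b = b * (b⁻¹ * e * b) := by
  have h := idem_comm he (idem_cod b)
  calc e * b = e * (b * b⁻¹) * b := by rw [mul_assoc, mul_assoc, mul_inv_mul]
    _ = b * (b⁻¹ * e * b) := by rw [h]; simp only [mul_assoc]

theorem idem_conj {e : S} (he : e * e = e) (b : S) :
    b⁻¹ * e * b * (b⁻¹ * e * b) = b⁻¹ * e * b := by
  have h := idem_comm he (idem_cod b)
  calc b⁻¹ * e * b * (b⁻¹ * e * b) = b⁻¹ * (e * (b * b⁻¹)) * e * b := by simp only [mul_assoc]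
    _ = b⁻¹ * (b * b⁻¹) * (e * e) * b := by rw [h]; simp only [mul_assoc]
    _ = b⁻¹ * e * b := by rw [inv_mul_inv, he]

theorem eq_of_eq_mul_idem {a b e : S} (he : e * e = e) (h : a = b * e) :
    a = b * (a⁻¹ * a) := by
  have h1 := idem_comm he (idem_dom b)
  have h2 : a⁻¹ * a = b⁻¹ * b * e := by
    calc a⁻¹ * a = e * (b⁻¹ * b) * e := by
          rw [h, mul_inv_rev', idem_inv he]; simp only [mul_assoc]
      _ = b⁻¹ * b * e := by rw [h1, mul_assoc, he]
  rw [h2, ← mul_assoc, mul_inv_mul, h]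

/-- The natural partial order: `a ≤ b` iff `a = b a⁻¹ a`. -/
instance naturalOrder : PartialOrder S where
  le a b := a = b * (a⁻¹ * a)
  le_refl a := (mul_inv_mul a).symm
  le_trans a b c hab hbc := by
    change a = b * (a⁻¹ * a) at hab
    change b = c * (b⁻¹ * b) at hbc
    refine eq_of_eq_mul_idem (idem_mul (idem_dom b) (idem_dom a)) ?_
    rw [← mul_assoc, ← hbc, ← hab]
  le_antisymm a b hab hba := by
    change a = b * (a⁻¹ * a) at hab
    change b = a * (b⁻¹ * b) at hba
    calc a = b * (a⁻¹ * a) := hab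
      _ = a * (b⁻¹ * b) * (a⁻¹ * a) := by rw [← hba]
      _ = a * (a⁻¹ * a) * (b⁻¹ * b) := by
          rw [mul_assoc, idem_comm (idem_dom b) (idem_dom a), ← mul_assoc]
      _ = b := by rw [mul_inv_mul, ← hba]

theorem le_def {a b : S} : a ≤ b ↔ a = b * (a⁻¹ * a) := Iff.rfl

theorem le_of_eq_mul_idem {a b e : S} (he : e * e = e) (h : a = b * e) : a ≤ b :=
  eq_of_eq_mul_idem he h

theorem le_of_eq_idem_mul {a b e : S} (he : e * e = e) (h : a = e * b) : a ≤ b :=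
  le_of_eq_mul_idem (idem_conj he b) (h.trans (idem_slide he b))

theorem mul_le_left (s : S) {a b : S} (h : a ≤ b) : s * a ≤ s * b :=
  le_of_eq_mul_idem (idem_dom a) (by rw [mul_assoc, ← le_def.1 h])

theorem mul_le_right {a b : S} (h : a ≤ b) (s : S) : a * s ≤ b * s := by
  refine le_of_eq_mul_idem (idem_conj (idem_dom a) s) ?_
  rw [mul_assoc, ← idem_slide (idem_dom a), ← mul_assoc, ← le_def.1 h]

theorem mul_le {a b c d : S} (h : a ≤ b) (h' : c ≤ d) : a * c ≤ b * d :=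
  (mul_le_left a h').trans (mul_le_right h d)

theorem inv_le {a b : S} (h : a ≤ b) : a⁻¹ ≤ b⁻¹ := by
  refine le_of_eq_idem_mul (idem_dom a) ?_
  have h1 : a⁻¹ = (b * (a⁻¹ * a))⁻¹ := by rw [← le_def.1 h]
  rwa [mul_inv_rev', idem_inv (idem_dom a)] at h1

theorem dom_mul_le (s a : S) : s⁻¹ * (s * a) ≤ a :=
  le_of_eq_idem_mul (idem_dom s) (mul_assoc _ _ _).symm

theorem cod_mul_le (s a : S) : s * (s⁻¹ * a) ≤ a :=
  le_of_eq_idem_mul (idem_cod s) (mul_assoc _ _ _).symm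

/-- An element acts as a left identity on elements whose range lies below it. -/
theorem idem_mul_of_le {e b : S} (h : b * b⁻¹ ≤ e) : e * b = b := by
  have h1 : b * b⁻¹ = e * (b * b⁻¹) := by
    have := le_def.1 h
    rwa [idem_inv (idem_cod b), idem_cod] at this
  calc e * b = e * (b * b⁻¹) * b := by rw [mul_assoc, mul_assoc, mul_inv_mul]
    _ = b := by rw [← h1, mul_assoc, mul_inv_mul]

/-- Elements below `s * a` are fixed by `s s⁻¹` on the left. -/
theorem cod_mul_of_le {s a z : S} (h : z ≤ s * a) : s * (s⁻¹ * z) = z := by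
  rw [le_def.1 h]
  have : s * (s⁻¹ * s) = s := mul_inv_mul s
  calc s * (s⁻¹ * (s * a * (z⁻¹ * z))) = s * (s⁻¹ * s) * a * (z⁻¹ * z) := by
        simp only [mul_assoc]
    _ = s * a * (z⁻¹ * z) := by rw [this]

/-- A least element is absorbing. -/
theorem isBot_mul {z : S} (hz : IsBot z) (s : S) : IsBot (s * z) := by
  have h1 : z = s * z * (z⁻¹ * z) := hz (s * z)
  have h2 : s * z = z := by rw [mul_assoc, mul_inv_mul] at h1; exact h1.symm
  rwa [h2]

theorem isBot_inv {z : S} (hz : IsBot z) : IsBot z⁻¹ := fun b => by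
  have := inv_le (hz b⁻¹); rwa [invinv] at this

theorem isBot_of_le {y z : S} (hz : IsBot z) (h : y ≤ z) : IsBot y := fun b => h.trans (hz b)

end Basic

/-! ### Compatibility, joins, distributive inverse semigroups -/

/-- `s` and `t` are compatible if `s⁻¹ t` and `s t⁻¹` are idempotents. -/
def Compatible {S : Type u} [InverseSemigroup S] (s t : S) : Prop :=
  IsIdempotentElem (s⁻¹ * t) ∧ IsIdempotentElem (s * t⁻¹)

/-- A set is compatible if its elements are pairwise compatible. -/
def IsCompatibleSet {S : Type u} [InverseSemigroup S] (X : Set S) : Prop :=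
  ∀ s ∈ X, ∀ t ∈ X, Compatible s t

/-- A distributive inverse semigroup: finite compatible subsets have joins (the empty one included,
so that there is a zero), and multiplication distributes over the finite joins that exist. -/
class DistributiveInverseSemigroup (S : Type u) extends InverseSemigroup S where
  exists_isLUB : ∀ X : Set S, X.Finite → IsCompatibleSet X → ∃ a, IsLUB X a
  mul_isLUB : ∀ (X : Set S) (a s : S), X.Finite → IsLUB X a → IsLUB ((fun x => s * x) '' X) (s * a)
  isLUB_mul : ∀ (X : Set S) (a s : S), X.Finite → IsLUB X a → IsLUB ((fun x => x * s) '' X) (a * s)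

/-- A morphism of distributive inverse semigroups: a semigroup homomorphism that preserves the
joins of finite compatible subsets. -/
def IsDistributiveMorphism {D : Type u} {T : Type v} [DistributiveInverseSemigroup D]
    [DistributiveInverseSemigroup T] (φ : D →ₙ* T) : Prop :=
  ∀ (X : Set D) (a : D), X.Finite → IsCompatibleSet X → IsLUB X a → IsLUB (φ '' X) (φ a)

/-- All binary meets exist. -/
def IsInverseMeetSemigroup (S : Type u) [InverseSemigroup S] : Prop :=
  ∀ a b : S, ∃ c, IsGLB {a, b} c

/-- The weak meet condition: the intersection of any two principal order ideals is a finitely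
generated order ideal. -/
def WeakMeetCondition (S : Type u) [InverseSemigroup S] : Prop :=
  ∀ a b : S, ∃ F : Set S, F.Finite ∧ Set.Iic a ∩ Set.Iic b = (lowerClosure F : Set S)

/-! ### The tight coverage and tight maps -/

/-- The arrow relation `a → B`: for each non-zero `x ≤ a` there is `b ∈ B` such that `x` and `b`
have a non-zero common lower bound. An element is zero if it is the least element. -/
def Arrow {S : Type u} [InverseSemigroup S] (a : S) (B : Set S) : Prop :=
  ∀ x ≤ a, ¬ IsBot x → ∃ b ∈ B, ∃ y, ¬ IsBot y ∧ y ≤ x ∧ y ≤ b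

/-- The tight coverage: `X` is a finite set of elements below `a` with `a → X`. -/
def TightCover {S : Type u} [InverseSemigroup S] (a : S) (X : Set S) : Prop :=
  X.Finite ∧ X ⊆ Set.Iic a ∧ Arrow a X

/-- A tight map: a semigroup homomorphism to a distributive inverse semigroup that turns
tight covers into joins. -/
def IsTightMap {S : Type u} {T : Type v} [InverseSemigroup S] [DistributiveInverseSemigroup T]
    (θ : S →ₙ* T) : Prop :=
  ∀ (a : S) (X : Set S), TightCover a X → IsLUB (θ '' X) (θ a)

/-! ### Étale groupoids -/

/-- A groupoid, as a set with an involution and a partially defined associative multiplication;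
`Comp x y` says that the product `xy` exists. -/
class PGroupoid (G : Type u) where
  inv : G → G
  Comp : G → G → Prop
  mul : ∀ x y, Comp x y → G
  inv_inv : ∀ x, inv (inv x) = x
  comp_mul_left : ∀ {x y z} (hxy : Comp x y), Comp y z → Comp (mul x y hxy) z
  comp_mul_right : ∀ {x y z} (_ : Comp x y) (hyz : Comp y z), Comp x (mul y z hyz)
  assoc : ∀ {x y z} (hxy : Comp x y) (hyz : Comp y z),
    mul (mul x y hxy) z (comp_mul_left hxy hyz) = mul x (mul y z hyz) (comp_mul_right hxy hyz)
  inv_comp : ∀ x, Comp (inv x) x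
  comp_inv : ∀ x, Comp x (inv x)
  inv_mul_cancel : ∀ {x y} (h : Comp x y),
    mul (inv x) (mul x y h) (comp_mul_right (inv_comp x) h) = y
  mul_inv_cancel : ∀ {z x} (h : Comp z x),
    mul (mul z x h) (inv x) (comp_mul_left h (comp_inv x)) = z

/-- The domain map `x ↦ x⁻¹ x`. Its range is the set of identities. -/
def PGroupoid.d {G : Type u} [PGroupoid G] (x : G) : G :=
  PGroupoid.mul (PGroupoid.inv x) x (PGroupoid.inv_comp x)

/-- An étale groupoid: a topological groupoid (multiplication and inversion are continuous) whose
domain map, as a map to the space of identities, is a local homeomorphism. -/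
structure IsEtaleGroupoid (G : Type u) [TopologicalSpace G] [PGroupoid G] : Prop where
  continuous_inv : Continuous (PGroupoid.inv : G → G)
  continuous_mul : Continuous (fun p : {p : G × G // PGroupoid.Comp p.1 p.2} =>
    PGroupoid.mul p.1.1 p.1.2 p.2)
  isLocalHomeomorph : IsLocalHomeomorph (Set.rangeFactorization (PGroupoid.d : G → G))

/-- A homeomorphism of topological groupoids: a homeomorphism of the underlying spaces that is also
an isomorphism of groupoids. -/
structure GroupoidHomeomorph (G : Type u) (H : Type v) [TopologicalSpace G] [PGroupoid G]
    [TopologicalSpace H] [PGroupoid H] extends G ≃ₜ H where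
  comp_iff : ∀ x y : G, PGroupoid.Comp (toFun x) (toFun y) ↔ PGroupoid.Comp x y
  map_mul : ∀ (x y : G) (h : PGroupoid.Comp x y),
    toFun (PGroupoid.mul x y h) = PGroupoid.mul (toFun x) (toFun y) ((comp_iff x y).2 h)

/-- The groupoid structure on a subset closed under inversion and products. -/
@[reducible] def PGroupoid.sub {G : Type u} [PGroupoid G] (p : G → Prop)
    (hinv : ∀ x, p x → p (PGroupoid.inv x))
    (hmul : ∀ x y (h : PGroupoid.Comp x y), p x → p y → p (PGroupoid.mul x y h)) :
    PGroupoid {x : G // p x} where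
  inv x := ⟨PGroupoid.inv x.1, hinv x.1 x.2⟩
  Comp x y := PGroupoid.Comp x.1 y.1
  mul x y h := ⟨PGroupoid.mul x.1 y.1 h, hmul x.1 y.1 h x.2 y.2⟩
  inv_inv x := Subtype.ext (PGroupoid.inv_inv x.1)
  comp_mul_left hxy hyz := PGroupoid.comp_mul_left hxy hyz
  comp_mul_right hxy hyz := PGroupoid.comp_mul_right hxy hyz
  assoc hxy hyz := Subtype.ext (PGroupoid.assoc hxy hyz)
  inv_comp x := PGroupoid.inv_comp x.1
  comp_inv x := PGroupoid.comp_inv x.1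
  inv_mul_cancel h := Subtype.ext (PGroupoid.inv_mul_cancel h)
  mul_inv_cancel h := Subtype.ext (PGroupoid.mul_inv_cancel h)

/-! ### The groupoid of filters -/

/-- The upward closure of a set. -/
def up {S : Type u} [InverseSemigroup S] (X : Set S) : Set S := {s | ∃ x ∈ X, x ≤ s}

/-- A proper filter: a non-empty, down-directed, upward closed subset without zero. -/
structure ProperFilter (S : Type u) [InverseSemigroup S] where
  carrier : Set S
  nonempty : carrier.Nonempty
  directed : ∀ a ∈ carrier, ∀ b ∈ carrier, ∃ c ∈ carrier, c ≤ a ∧ c ≤ b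
  mem_of_le : ∀ a ∈ carrier, ∀ b, a ≤ b → b ∈ carrier
  proper : ∀ a ∈ carrier, ¬ IsBot a

namespace ProperFilter

section Sets

variable {S : Type u} [InverseSemigroup S]

theorem up_mul (X Y : Set S) : up (up X * Y) = up (X * Y) := by
  ext s
  constructor
  · rintro ⟨_, ⟨x, ⟨x', hx', hle⟩, y, hy, rfl⟩, hs⟩
    exact ⟨x' * y, ⟨x', hx', y, hy, rfl⟩, (mul_le_right hle y).trans hs⟩
  · rintro ⟨_, ⟨x, hx, y, hy, rfl⟩, hs⟩
    exact ⟨_, ⟨x, ⟨x, hx, le_rfl⟩, y, hy, rfl⟩, hs⟩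

theorem mul_up (X Y : Set S) : up (X * up Y) = up (X * Y) := by
  ext s
  constructor
  · rintro ⟨_, ⟨x, hx, y, ⟨y', hy', hle⟩, rfl⟩, hs⟩
    exact ⟨x * y', ⟨x, hx, y', hy', rfl⟩, (mul_le_left x hle).trans hs⟩
  · rintro ⟨_, ⟨x, hx, y, hy, rfl⟩, hs⟩
    exact ⟨_, ⟨x, hx, y, ⟨y, hy, le_rfl⟩, rfl⟩, hs⟩

theorem set_inv_inv (X : Set S) : X⁻¹⁻¹ = X := by
  ext s; simp only [Set.mem_inv, invinv]

theorem up_inv (X : Set S) : (up X)⁻¹ = up X⁻¹ := by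
  ext s
  constructor
  · rintro ⟨x, hx, hle⟩
    refine ⟨x⁻¹, ?_, ?_⟩
    · rwa [Set.mem_inv, invinv]
    · have := inv_le hle; rwa [invinv] at this
  · rintro ⟨x, hx, hle⟩
    exact ⟨x⁻¹, hx, inv_le hle⟩

theorem set_mul_inv (X Y : Set S) : (X * Y)⁻¹ = Y⁻¹ * X⁻¹ := by
  ext s
  constructor
  · rintro ⟨x, hx, y, hy, h⟩
    refine ⟨y⁻¹, by rwa [Set.mem_inv, invinv], x⁻¹, by rwa [Set.mem_inv, invinv], ?_⟩
    change x * y = s⁻¹ at h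
    change y⁻¹ * x⁻¹ = s
    rw [← mul_inv_rev', h, invinv]
  · rintro ⟨y, hy, x, hx, rfl⟩
    refine ⟨x⁻¹, hx, y⁻¹, hy, ?_⟩
    change x⁻¹ * y⁻¹ = (y * x)⁻¹
    rw [mul_inv_rev']

theorem set_assoc (X Y Z : Set S) : X * Y * Z = X * (Y * Z) := by
  ext s
  constructor
  · rintro ⟨_, ⟨x, hx, y, hy, rfl⟩, z, hz, rfl⟩
    exact ⟨x, hx, _, ⟨y, hy, z, hz, rfl⟩, (mul_assoc x y z).symm⟩
  · rintro ⟨x, hx, _, ⟨y, hy, z, hz, rfl⟩, rfl⟩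
    exact ⟨_, ⟨x, hx, y, hy, rfl⟩, z, hz, mul_assoc x y z⟩

end Sets

variable {S : Type u} [InverseSemigroup S]

instance instMembership : Membership S (ProperFilter S) := ⟨fun F s => s ∈ F.carrier⟩

@[ext] theorem ext {F G : ProperFilter S} (h : F.carrier = G.carrier) : F = G := by
  cases F; cases G; cases h; rfl

theorem up_carrier (F : ProperFilter S) : up F.carrier = F.carrier := by
  ext s
  exact ⟨fun ⟨x, hx, h⟩ => F.mem_of_le x hx s h, fun hs => ⟨s, hs, le_rfl⟩⟩

/-- `F⁻¹`. -/
def inv (F : ProperFilter S) : ProperFilter S where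
  carrier := F.carrier⁻¹
  nonempty := by
    obtain ⟨a, ha⟩ := F.nonempty
    exact ⟨a⁻¹, by rwa [Set.mem_inv, invinv]⟩
  directed a ha b hb := by
    obtain ⟨c, hc, h1, h2⟩ := F.directed _ ha _ hb
    refine ⟨c⁻¹, by rwa [Set.mem_inv, invinv], ?_, ?_⟩
    · have := inv_le h1; rwa [invinv] at this
    · have := inv_le h2; rwa [invinv] at this
  mem_of_le a ha b h := F.mem_of_le _ ha _ (inv_le h)
  proper a ha h := F.proper _ ha (isBot_inv h)

/-- `d(F) = (F⁻¹ F)↑`, as a set. -/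
def dom (F : ProperFilter S) : Set S := up (F.carrier⁻¹ * F.carrier)

/-- `r(F) = (F F⁻¹)↑`, as a set. -/
def cod (F : ProperFilter S) : Set S := up (F.carrier * F.carrier⁻¹)

theorem refine_right {F G : ProperFilter S} (h : F.dom = G.cod) {a b : S} (ha : a ∈ F.carrier)
    (hb : b ∈ G.carrier) : ∃ c ∈ G.carrier, c ≤ b ∧ a⁻¹ * (a * c) = c := by
  have h1 : a⁻¹ * a ∈ G.cod := by
    rw [← h]
    exact ⟨_, ⟨a⁻¹, by rwa [Set.mem_inv, invinv], a, ha, rfl⟩, le_rfl⟩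
  obtain ⟨_, ⟨p, hp, q, hq, rfl⟩, hle⟩ := h1
  obtain ⟨r, hr, hrp, hrq⟩ := G.directed p hp _ hq
  obtain ⟨c, hc, hcr, hcb⟩ := G.directed r hr b hb
  refine ⟨c, hc, hcb, ?_⟩
  have h2 : c * c⁻¹ ≤ a⁻¹ * a := by
    refine le_trans (mul_le (hcr.trans hrp) ?_) hle
    have := inv_le (hcr.trans hrq)
    rwa [invinv] at this
  rw [← mul_assoc]
  exact idem_mul_of_le h2

/-- The product `F · G = (F G)↑`, defined when `d(F) = r(G)`. -/
def mul (F G : ProperFilter S) (h : F.dom = G.cod) : ProperFilter S where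
  carrier := up (F.carrier * G.carrier)
  nonempty := by
    obtain ⟨a, ha⟩ := F.nonempty
    obtain ⟨b, hb⟩ := G.nonempty
    exact ⟨a * b, _, ⟨a, ha, b, hb, rfl⟩, le_rfl⟩
  directed := by
    rintro s ⟨_, ⟨a, ha, b, hb, rfl⟩, hs⟩ t ⟨_, ⟨a', ha', b', hb', rfl⟩, ht⟩
    obtain ⟨p, hp, hpa, hpa'⟩ := F.directed a ha a' ha'
    obtain ⟨q, hq, hqb, hqb'⟩ := G.directed b hb b' hb'
    exact ⟨p * q, ⟨_, ⟨p, hp, q, hq, rfl⟩, le_rfl⟩, (mul_le hpa hqb).trans hs,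
      (mul_le hpa' hqb').trans ht⟩
  mem_of_le := by
    rintro s ⟨x, hx, hs⟩ t ht
    exact ⟨x, hx, hs.trans ht⟩
  proper := by
    rintro s ⟨_, ⟨a, ha, b, hb, rfl⟩, hs⟩ hbot
    obtain ⟨c, hc, hcb, hac⟩ := refine_right h ha hb
    refine G.proper c hc ?_
    rw [← hac]
    exact isBot_mul (isBot_of_le hbot ((mul_le_left a hcb).trans hs)) _

theorem triple (F : ProperFilter S) :
    up (F.carrier * (F.carrier⁻¹ * F.carrier)) = F.carrier := by
  ext s
  constructor
  · rintro ⟨_, ⟨a, ha, _, ⟨b, hb, c, hc, rfl⟩, rfl⟩, hs⟩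
    obtain ⟨p, hp, hpa, hpb⟩ := F.directed a ha _ hb
    obtain ⟨q, hq, hqp, hqc⟩ := F.directed p hp c hc
    refine F.mem_of_le q hq s (le_trans ?_ hs)
    have h1 : q⁻¹ ≤ b := by
      have := inv_le (hqp.trans hpb); rwa [invinv] at this
    calc q = q * (q⁻¹ * q) := (mul_inv_mul q).symm
      _ ≤ a * (b * c) := mul_le (hqp.trans hpa) (mul_le h1 hqc)
  · intro hs
    exact ⟨_, ⟨s, hs, _, ⟨s⁻¹, by rwa [Set.mem_inv, invinv], s, hs, rfl⟩, rfl⟩,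
      (mul_inv_mul s).le⟩

theorem dom_inv (F : ProperFilter S) : F.inv.dom = F.cod := by
  change up (F.carrier⁻¹⁻¹ * F.carrier⁻¹) = _
  rw [set_inv_inv]; rfl

theorem cod_inv (F : ProperFilter S) : F.inv.cod = F.dom := by
  change up (F.carrier⁻¹ * F.carrier⁻¹⁻¹) = _
  rw [set_inv_inv]; rfl

/-- `(d(F) G)↑ = G` if `d(F) = r(G)`. -/
theorem dom_mul_eq {F G : ProperFilter S} (h : F.dom = G.cod) :
    up (F.carrier⁻¹ * (F.carrier * G.carrier)) = G.carrier := by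
  rw [← set_assoc, ← up_mul]
  change up (F.dom * G.carrier) = _
  rw [h]
  change up (up _ * _) = _
  rw [up_mul, set_assoc, triple]

/-- `(F r(G))↑ = F` if `d(F) = r(G)`. -/
theorem mul_cod_eq {F G : ProperFilter S} (h : F.dom = G.cod) :
    up (F.carrier * G.carrier * G.carrier⁻¹) = F.carrier := by
  rw [set_assoc, ← mul_up]
  change up (F.carrier * G.cod) = _
  rw [← h]
  change up (_ * up _) = _
  rw [mul_up, triple]

theorem dom_mul {F G : ProperFilter S} (h : F.dom = G.cod) : (F.mul G h).dom = G.dom := by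
  change up ((up (F.carrier * G.carrier))⁻¹ * up (F.carrier * G.carrier)) = _
  rw [up_inv, up_mul, mul_up, set_mul_inv, set_assoc, ← mul_up, dom_mul_eq h]; rfl

theorem cod_mul {F G : ProperFilter S} (h : F.dom = G.cod) : (F.mul G h).cod = F.cod := by
  change up (up (F.carrier * G.carrier) * (up (F.carrier * G.carrier))⁻¹) = _
  rw [up_inv, up_mul, mul_up, set_mul_inv, ← set_assoc, ← up_mul, mul_cod_eq h]; rfl

/-- The groupoid of all proper filters. -/
instance instPGroupoid : PGroupoid (ProperFilter S) where
  inv := inv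
  Comp F G := F.dom = G.cod
  mul := mul
  inv_inv F := ext (set_inv_inv F.carrier)
  comp_mul_left hxy hyz := (dom_mul hxy).trans hyz
  comp_mul_right hxy hyz := hxy.trans (cod_mul hyz).symm
  assoc {F G H} hxy hyz := by
    apply ext
    change up (up (F.carrier * G.carrier) * H.carrier) =
      up (F.carrier * up (G.carrier * H.carrier))
    rw [up_mul, mul_up, set_assoc]
  inv_comp F := dom_inv F
  comp_inv F := (cod_inv F).symm
  inv_mul_cancel {F G} h := by
    apply ext
    change up (F.carrier⁻¹ * up (F.carrier * G.carrier)) = G.carrier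
    rw [mul_up, dom_mul_eq h]
  mul_inv_cancel {F G} h := by
    apply ext
    change up (up (F.carrier * G.carrier) * G.carrier⁻¹) = F.carrier
    rw [up_mul, mul_cod_eq h]

/-- Tight filters: a filter that meets every tight cover of each of its elements. -/
def IsTight (F : ProperFilter S) : Prop :=
  ∀ a ∈ F, ∀ X : Set S, TightCover a X → ∃ x ∈ X, x ∈ F

/-- Prime filters: `a ∨ b ∈ F` implies `a ∈ F` or `b ∈ F`. -/
def IsPrime (F : ProperFilter S) : Prop :=
  ∀ a b c : S, IsLUB {a, b} c → c ∈ F → a ∈ F ∨ b ∈ F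

end ProperFilter

section Closure

variable {S : Type u} [InverseSemigroup S]

theorem TightCover.inv {a : S} {X : Set S} (h : TightCover a X) :
    TightCover a⁻¹ ((fun x => x⁻¹) '' X) := by
  obtain ⟨hfin, hsub, harr⟩ := h
  refine ⟨hfin.image _, ?_, ?_⟩
  · rintro _ ⟨x, hx, rfl⟩
    exact inv_le (hsub hx)
  · intro x hx hx0
    have hxa : x⁻¹ ≤ a := by have := inv_le hx; rwa [invinv] at this
    obtain ⟨b, hb, y, hy0, hyx, hyb⟩ := harr x⁻¹ hxa
      (fun h => hx0 (by have := isBot_inv h; rwa [invinv] at this))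
    refine ⟨b⁻¹, ⟨b, hb, rfl⟩, y⁻¹,
      fun h => hy0 (by have := isBot_inv h; rwa [invinv] at this), ?_, inv_le hyb⟩
    have := inv_le hyx; rwa [invinv] at this

theorem TightCover.mul_left {a : S} {X : Set S} (h : TightCover a X) (s : S) :
    TightCover (s * a) ((fun x => s * x) '' X) := by
  obtain ⟨hfin, hsub, harr⟩ := h
  refine ⟨hfin.image _, ?_, ?_⟩
  · rintro _ ⟨x, hx, rfl⟩
    exact mul_le_left s (hsub hx)
  · intro z hz hz0
    have e1 : s * (s⁻¹ * z) = z := cod_mul_of_le hz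
    obtain ⟨b, hb, u, hu0, huz, hub⟩ := harr (s⁻¹ * z)
      ((mul_le_left s⁻¹ hz).trans (dom_mul_le s a))
      (fun h => hz0 (by rw [← e1]; exact isBot_mul h s))
    have e2 : s⁻¹ * (s * u) = u := by
      have := cod_mul_of_le huz; rwa [invinv] at this
    refine ⟨s * b, ⟨b, hb, rfl⟩, s * u, fun h => hu0 (by rw [← e2]; exact isBot_mul h _), ?_,
      mul_le_left s hub⟩
    have := mul_le_left s huz
    rwa [e1] at this

theorem ProperFilter.IsTight.inv {F : ProperFilter S} (hF : F.IsTight) : F.inv.IsTight := by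
  intro a ha X hX
  obtain ⟨_, ⟨x, hx, rfl⟩, hxF⟩ := hF a⁻¹ ha _ hX.inv
  exact ⟨x, hx, hxF⟩

theorem ProperFilter.IsTight.mul {F G : ProperFilter S} (hG : G.IsTight) (h : F.dom = G.cod) :
    (F.mul G h).IsTight := by
  rintro x ⟨_, ⟨a, ha, b, hb, rfl⟩, hx⟩ X hX
  obtain ⟨c, hc, hcb, hac⟩ := refine_right h ha hb
  have h1 : a⁻¹ * x ∈ G.carrier := by
    refine G.mem_of_le c hc _ ?_
    rw [← hac]
    exact mul_le_left _ ((mul_le_left a hcb).trans hx)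
  obtain ⟨_, ⟨y, hy, rfl⟩, hyG⟩ := hG _ h1 _ (hX.mul_left a⁻¹)
  exact ⟨y, hy, _, ⟨a, ha, _, hyG, rfl⟩, cod_mul_le a y⟩

theorem ProperFilter.IsPrime.inv {F : ProperFilter S} (hF : F.IsPrime) : F.inv.IsPrime := by
  intro a b c hc hcF
  refine hF a⁻¹ b⁻¹ c⁻¹ ⟨?_, ?_⟩ hcF
  · rintro _ (rfl | rfl)
    · exact inv_le (hc.1 (Or.inl rfl))
    · exact inv_le (hc.1 (Or.inr rfl))
  · intro w hw
    have h1 : c ≤ w⁻¹ := by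
      refine hc.2 ?_
      rintro _ (rfl | rfl)
      · have := inv_le (hw (Or.inl rfl)); rwa [invinv] at this
      · have := inv_le (hw (Or.inr rfl)); rwa [invinv] at this
    have := inv_le h1; rwa [invinv] at this

theorem ProperFilter.IsPrime.mul {D : Type u} [DistributiveInverseSemigroup D]
    {F G : ProperFilter D} (hG : G.IsPrime) (h : F.dom = G.cod) : (F.mul G h).IsPrime := by
  rintro p q x hpq ⟨_, ⟨a, ha, b, hb, rfl⟩, hx⟩
  obtain ⟨c, hc, hcb, hac⟩ := refine_right h ha hb
  have h1 : a⁻¹ * x ∈ G.carrier := by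
    refine G.mem_of_le c hc _ ?_
    rw [← hac]
    exact mul_le_left _ ((mul_le_left a hcb).trans hx)
  have h2 := DistributiveInverseSemigroup.mul_isLUB {p, q} x a⁻¹ (Set.toFinite _) hpq
  rw [Set.image_pair] at h2
  rcases hG _ _ _ h2 h1 with h3 | h3
  · exact Or.inl ⟨_, ⟨a, ha, _, h3, rfl⟩, cod_mul_le a p⟩
  · exact Or.inr ⟨_, ⟨a, ha, _, h3, rfl⟩, cod_mul_le a q⟩

end Closure

/-! ### The tight groupoid and the prime spectrum -/

/-- The set of (proper) tight filters of `S`. -/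
def TightFilter (S : Type u) [InverseSemigroup S] : Type u :=
  {F : ProperFilter S // F.IsTight}

/-- The set of (proper) prime filters of `D`. -/
def PrimeFilter (D : Type u) [DistributiveInverseSemigroup D] : Type u :=
  {F : ProperFilter D // F.IsPrime}

instance TightFilter.instPGroupoid (S : Type u) [InverseSemigroup S] :
    PGroupoid (TightFilter S) :=
  PGroupoid.sub ProperFilter.IsTight (fun _ h => h.inv) (fun _ _ h _ hG => hG.mul h)

instance PrimeFilter.instPGroupoid (D : Type u) [DistributiveInverseSemigroup D] :
    PGroupoid (PrimeFilter D) :=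
  PGroupoid.sub ProperFilter.IsPrime (fun _ h => h.inv) (fun _ _ h _ hG => hG.mul h)

/-- The topology on tight filters with basic open sets `{F | s ∈ F}`, `s ∈ S`. -/
instance TightFilter.instTopologicalSpace (S : Type u) [InverseSemigroup S] :
    TopologicalSpace (TightFilter S) :=
  TopologicalSpace.generateFrom (Set.range fun s : S => {F : TightFilter S | s ∈ F.1})

/-- The topology on prime filters with basic open sets `{F | s ∈ F}`, `s ∈ D`. -/
instance PrimeFilter.instTopologicalSpace (D : Type u) [DistributiveInverseSemigroup D] :
    TopologicalSpace (PrimeFilter D) :=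
  TopologicalSpace.generateFrom (Set.range fun s : D => {F : PrimeFilter D | s ∈ F.1})

end InvSem

/-! Tight covers are stable under inversion and one-sided multiplication, and they compose. Hence
`tightClosure` is a closure operator on subsets of `S` that respects products:
`tightClosure_mul_tightClosure` says that closing the factors does not change the closure of the
product. The completion consists of finitely generated closed sets, with the closure of the
elementwise product as multiplication, inclusion as natural order (`le_iff`) and closures of unions
as joins.

Compatibility has to be weakened to what a tight map can see. An element tightly covered by
idempotents is sent to a join of idempotents, hence to an idempotent, so `s⁻¹ * t` and `s * t⁻¹` are
only required to be such essential idempotents.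

A tight map `θ` gives the same upper bounds on `A` as on its closure
(`upperBounds_image_tightClosure`), so it extends by sending `U` to the join of `θ` over any finite
generating set. Every `U` is a finite join of principal elements, which forces uniqueness.

A tight filter that meets the closure of `A` meets the upward closed filter already in `A`
(`exists_mem_of_tightClosure`). A prime filter containing a finite join contains a member of it, so
it is determined by its principal elements. These two facts make the tight filters of `S` correspond
to the prime filters of the completion. Both groupoids are étale because a filter is determined by
its domain and any one member, and `translate` realises every admissible such pair. Under the weak
meet condition, the intersection of two finitely generated closed sets is again finitely generated,
and it is their meet. -/

namespace InvSem

/-! ### Idempotents, compatibility and finite joins. -/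

section Order

variable {S : Type u} [InverseSemigroup S]

theorem idem_of_le {a e : S} (he : e * e = e) (h : a ≤ e) : a * a = a := by
  have := idem_mul he (idem_dom a)
  rwa [← le_def.1 h] at this

theorem compatible_of_le {s t b : S} (hs : s ≤ b) (ht : t ≤ b) : Compatible s t :=
  ⟨idem_of_le (idem_dom b) (mul_le (inv_le hs) ht), idem_of_le (idem_cod b) (mul_le hs (inv_le ht))⟩

/-- A finite join of idempotents is idempotent. -/
theorem idem_of_isLUB {D : Type v} [DistributiveInverseSemigroup D] {X : Set D} {c : D}
    (hfin : X.Finite) (hX : ∀ x ∈ X, x * x = x) (hc : IsLUB X c) : c * c = c := by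
  -- By distributivity `c * c` is the join of `c * X`, and `c * X = X` because `c` fixes every
  -- idempotent below it.
  refine (DistributiveInverseSemigroup.mul_isLUB X c c hfin hc).unique ?_
  convert hc using 1
  ext y
  have key : ∀ x ∈ X, c * x = x := fun x hx => by
    have h := le_def.1 (hc.1 hx)
    rw [idem_inv (hX x hx), hX x hx] at h
    exact h.symm
  constructor
  · rintro ⟨x, hx, rfl⟩
    change c * x ∈ X
    rwa [key x hx]
  · intro hy
    exact ⟨y, hy, key y hy⟩

/-- Multiplication distributes over a pair of finite joins. -/
theorem isLUB_mul_mul {D : Type v} [DistributiveInverseSemigroup D] {X Y : Set D} {c d : D}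
    (hX : X.Finite) (hY : Y.Finite) (hc : IsLUB X c) (hd : IsLUB Y d) :
    IsLUB (X * Y) (c * d) := by
  constructor
  · rintro _ ⟨x, hx, y, hy, rfl⟩
    exact mul_le (hc.1 hx) (hd.1 hy)
  · intro w hw
    refine (DistributiveInverseSemigroup.isLUB_mul X c d hX hc).2 ?_
    rintro _ ⟨x, hx, rfl⟩
    refine (DistributiveInverseSemigroup.mul_isLUB Y d x hY hd).2 ?_
    rintro _ ⟨y, hy, rfl⟩
    exact hw ⟨x, hx, y, hy, rfl⟩

end Order

/-! ### The closure operator of the tight coverage -/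

section Closure

variable {S : Type u} [InverseSemigroup S]

theorem TightCover.refl (a : S) : TightCover a {a} :=
  ⟨Set.finite_singleton a, by simp, fun x hx hx0 => ⟨a, rfl, x, hx0, le_rfl, hx⟩⟩

theorem TightCover.mul_right {a : S} {X : Set S} (h : TightCover a X) (s : S) :
    TightCover (a * s) ((fun x => x * s) '' X) := by
  have := (h.inv.mul_left s⁻¹).inv
  simpa only [Set.image_image, mul_inv_rev', invinv] using this

/-- A non-zero element below `a` shares a non-zero lower bound with some `x ∈ X`; that bound in turn
shares one with a member of the cover of `x`. -/
theorem TightCover.trans {a : S} {X C : Set S} (h : TightCover a X)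
    (hX : ∀ x ∈ X, ∃ Y, TightCover x Y ∧ Y ⊆ C) : ∃ Y, TightCover a Y ∧ Y ⊆ C := by
  choose! f hf hfC using hX
  refine ⟨⋃ x ∈ X, f x, ⟨h.1.biUnion fun x hx => (hf x hx).1, ?_, ?_⟩, Set.iUnion₂_subset hfC⟩
  · exact Set.iUnion₂_subset fun x hx y hy =>
      le_trans (Set.mem_Iic.1 ((hf x hx).2.1 hy)) (Set.mem_Iic.1 (h.2.1 hx))
  · intro z hz hz0
    obtain ⟨b, hb, y, hy0, hyz, hyb⟩ := h.2.2 z hz hz0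
    obtain ⟨c, hc, w, hw0, hwy, hwc⟩ := (hf b hb).2.2 y hyb hy0
    exact ⟨c, Set.mem_biUnion hb hc, w, hw0, hwy.trans hyz, hwc⟩

/-- The elements that have a tight cover by elements lying below elements of `A`. -/
def tightClosure (A : Set S) : Set S := {s | ∃ X, TightCover s X ∧ X ⊆ {x | ∃ a ∈ A, x ≤ a}}

theorem subset_tightClosure (A : Set S) : A ⊆ tightClosure A := fun a ha =>
  ⟨{a}, TightCover.refl a, by rintro _ rfl; exact ⟨_, ha, le_rfl⟩⟩

theorem TightCover.mem_tightClosure {a : S} {X : Set S} (h : TightCover a X) :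
    a ∈ tightClosure X := ⟨X, h, fun x hx => ⟨x, hx, le_rfl⟩⟩

theorem mem_tightClosure_of_le {A : Set S} {s t : S} (hs : s ∈ tightClosure A) (h : t ≤ s) :
    t ∈ tightClosure A := by
  obtain ⟨X, hX, hXA⟩ := hs
  -- Since `t = s * (t⁻¹ * t)`, restricting a cover of `s` by this idempotent covers `t`.
  have hc := hX.mul_right (t⁻¹ * t)
  rw [← le_def.1 h] at hc
  refine ⟨_, hc, ?_⟩
  rintro _ ⟨x, hx, rfl⟩
  obtain ⟨a, ha, hxa⟩ := hXA hx
  exact ⟨a, ha, (le_of_eq_mul_idem (idem_dom t) rfl).trans hxa⟩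

/-- Composition of covers. This serves as the induction principle for closures: only the generators
need checking. -/
theorem tightClosure_subset {A B : Set S} (h : A ⊆ tightClosure B) :
    tightClosure A ⊆ tightClosure B := by
  rintro s ⟨X, hX, hXA⟩
  refine hX.trans fun x hx => ?_
  obtain ⟨a, ha, hxa⟩ := hXA hx
  exact mem_tightClosure_of_le (h ha) hxa

theorem tightClosure_mono {A B : Set S} (h : A ⊆ B) : tightClosure A ⊆ tightClosure B :=
  tightClosure_subset (h.trans (subset_tightClosure B))

theorem tightClosure_idem (A : Set S) : tightClosure (tightClosure A) = tightClosure A :=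
  (tightClosure_subset subset_rfl).antisymm (subset_tightClosure _)

theorem inv_mem_tightClosure {A : Set S} {s : S} (hs : s ∈ tightClosure A) :
    s⁻¹ ∈ tightClosure A⁻¹ := by
  obtain ⟨X, hX, hXA⟩ := hs
  refine ⟨_, hX.inv, ?_⟩
  rintro _ ⟨x, hx, rfl⟩
  obtain ⟨a, ha, hxa⟩ := hXA hx
  exact ⟨a⁻¹, by rwa [Set.mem_inv, invinv], inv_le hxa⟩

theorem tightClosure_inv (A : Set S) : tightClosure A⁻¹ = (tightClosure A)⁻¹ := by
  ext s
  constructor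
  · intro hs
    have := inv_mem_tightClosure hs
    rwa [ProperFilter.set_inv_inv] at this
  · intro hs
    have := inv_mem_tightClosure hs
    rwa [invinv] at this

/-- If `X` covers `s` and `Y` covers `t`, then `X * t` covers `s * t` and each `x * t` is covered by
`x * Y`. -/
theorem mul_mem_tightClosure {A B : Set S} {s t : S} (hs : s ∈ tightClosure A)
    (ht : t ∈ tightClosure B) : s * t ∈ tightClosure (A * B) := by
  obtain ⟨X, hX, hXA⟩ := hs
  obtain ⟨Y, hY, hYB⟩ := ht
  refine (hX.mul_right t).trans ?_
  rintro _ ⟨x, hx, rfl⟩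
  refine ⟨_, hY.mul_left x, ?_⟩
  rintro _ ⟨y, hy, rfl⟩
  obtain ⟨a, ha, hxa⟩ := hXA hx
  obtain ⟨b, hb, hyb⟩ := hYB hy
  exact ⟨a * b, ⟨a, ha, b, hb, rfl⟩, mul_le hxa hyb⟩

theorem tightClosure_mul_subset (A B : Set S) :
    tightClosure A * tightClosure B ⊆ tightClosure (A * B) := by
  rintro _ ⟨s, hs, t, ht, rfl⟩
  exact mul_mem_tightClosure hs ht

theorem tightClosure_mul_tightClosure (A B : Set S) :
    tightClosure (tightClosure A * tightClosure B) = tightClosure (A * B) :=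
  (tightClosure_subset (tightClosure_mul_subset A B)).antisymm
    (tightClosure_mono (Set.mul_subset_mul (subset_tightClosure A) (subset_tightClosure B)))

variable (S) in
/-- The essential idempotents: elements with a tight cover by idempotents. -/
def essIdem : Set S := tightClosure {e : S | e * e = e}

theorem mul_mem_essIdem {s t : S} (hs : s ∈ essIdem S) (ht : t ∈ essIdem S) :
    s * t ∈ essIdem S := by
  refine tightClosure_mono ?_ (mul_mem_tightClosure hs ht)
  rintro _ ⟨e, he, f, hf, rfl⟩
  exact idem_mul he hf

/-- On generators this is `e * a ≤ a` for an idempotent `e`: up to tight covers, essential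
idempotents act as restrictions. -/
theorem essIdem_mul_mem {A : Set S} {n s : S} (hn : n ∈ essIdem S) (hs : s ∈ tightClosure A) :
    n * s ∈ tightClosure A := by
  refine tightClosure_subset ?_ (mul_mem_tightClosure hn hs)
  rintro _ ⟨e, he, a, ha, rfl⟩
  exact mem_tightClosure_of_le (subset_tightClosure A ha) (le_of_eq_idem_mul he rfl)

theorem mul_essIdem_mem {A : Set S} {n s : S} (hs : s ∈ tightClosure A) (hn : n ∈ essIdem S) :
    s * n ∈ tightClosure A := by
  refine tightClosure_subset ?_ (mul_mem_tightClosure hs hn)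
  rintro _ ⟨a, ha, e, he, rfl⟩
  exact mem_tightClosure_of_le (subset_tightClosure A ha) (le_of_eq_mul_idem he rfl)

theorem mul_essIdem_mul_mem {n s t : S} (hn : n ∈ essIdem S) (hst : s * t ∈ essIdem S) :
    s * n * t ∈ essIdem S := by
  have h := mul_mem_tightClosure (mul_mem_tightClosure (subset_tightClosure {s} rfl) hn)
    (subset_tightClosure {t} rfl)
  refine tightClosure_subset ?_ h
  rintro _ ⟨_, ⟨s, rfl, e, he, rfl⟩, t, rfl, rfl⟩
  exact mem_tightClosure_of_le hst (mul_le_right (le_of_eq_mul_idem he rfl) t)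

/-- Elements that become compatible under tight maps. -/
def EssCompatible (A : Set S) : Prop :=
  ∀ s ∈ A, ∀ t ∈ A, s⁻¹ * t ∈ essIdem S ∧ s * t⁻¹ ∈ essIdem S

theorem EssCompatible.tightClosure {A : Set S} (h : EssCompatible A) :
    EssCompatible (tightClosure A) := by
  intro s hs t ht
  constructor
  · refine tightClosure_subset ?_ (mul_mem_tightClosure (inv_mem_tightClosure hs) ht)
    rintro _ ⟨a, ha, b, hb, rfl⟩
    have := (h a⁻¹ ha b hb).1
    rwa [invinv] at this
  · refine tightClosure_subset ?_ (mul_mem_tightClosure hs (inv_mem_tightClosure ht))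
    rintro _ ⟨a, ha, b, hb, rfl⟩
    have := (h a ha b⁻¹ hb).2
    rwa [invinv] at this

theorem EssCompatible.mono {A B : Set S} (h : EssCompatible B) (hAB : A ⊆ B) :
    EssCompatible A := fun s hs t ht => h s (hAB hs) t (hAB ht)

theorem EssCompatible.inv {A : Set S} (h : EssCompatible A) : EssCompatible A⁻¹ := by
  intro s hs t ht
  have := h _ hs _ ht
  rw [invinv, invinv] at this
  exact this.symm

/-- Since `(a * b)⁻¹ * (c * d) = b⁻¹ * (a⁻¹ * c) * d`, an essential idempotent is inserted between
`b⁻¹` and `d`, which only shrinks the essential idempotent `b⁻¹ * d`; the other side is symmetric.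
-/
theorem EssCompatible.mul {A B : Set S} (hA : EssCompatible A) (hB : EssCompatible B) :
    EssCompatible (A * B) := by
  rintro _ ⟨a, ha, b, hb, rfl⟩ _ ⟨c, hc, d, hd, rfl⟩
  constructor
  · have := mul_essIdem_mul_mem (hA a ha c hc).1 (hB b hb d hd).1
    simpa only [mul_inv_rev', mul_assoc] using this
  · have := mul_essIdem_mul_mem (hB b hb d hd).2 (hA a ha c hc).2
    simpa only [mul_inv_rev', mul_assoc] using this

theorem essCompatible_singleton (s : S) : EssCompatible {s} := by
  rintro _ rfl _ rfl
  exact ⟨subset_tightClosure _ (idem_dom _), subset_tightClosure _ (idem_cod _)⟩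

end Closure

/-! ### The distributive completion with respect to the tight coverage -/

/-- The finitely generated, essentially compatible closed subsets of `S`. -/
structure TightCompletion (S : Type u) [InverseSemigroup S] where
  carrier : Set S
  finGen : ∃ A : Set S, A.Finite ∧ carrier = tightClosure A
  compat : EssCompatible carrier

namespace TightCompletion

variable {S : Type u} [InverseSemigroup S]

@[ext] theorem ext {U V : TightCompletion S} (h : U.carrier = V.carrier) : U = V := by
  cases U; cases V; cases h; rfl

theorem closure_eq (U : TightCompletion S) : tightClosure U.carrier = U.carrier := by
  obtain ⟨A, -, hA⟩ := U.finGen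
  rw [hA, tightClosure_idem]

theorem closure_subset {U : TightCompletion S} {A : Set S} (h : A ⊆ U.carrier) :
    tightClosure A ⊆ U.carrier :=
  (tightClosure_mono h).trans U.closure_eq.subset

theorem mem_of_le {U : TightCompletion S} {s t : S} (hs : s ∈ U.carrier) (h : t ≤ s) :
    t ∈ U.carrier := by
  rw [← U.closure_eq] at hs ⊢
  exact mem_tightClosure_of_le hs h

/-- The element generated by a finite essentially compatible set. -/
def gen (A : Set S) (hfin : A.Finite) (hA : EssCompatible A) : TightCompletion S :=
  ⟨tightClosure A, ⟨A, hfin, rfl⟩, hA.tightClosure⟩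

instance : Mul (TightCompletion S) where
  mul U V := ⟨tightClosure (U.carrier * V.carrier), by
    obtain ⟨A, hA, hUA⟩ := U.finGen
    obtain ⟨B, hB, hVB⟩ := V.finGen
    exact ⟨A * B, hA.mul hB, by rw [hUA, hVB, tightClosure_mul_tightClosure]⟩,
    (U.compat.mul V.compat).tightClosure⟩

instance : Inv (TightCompletion S) where
  inv U := ⟨U.carrier⁻¹, by
    obtain ⟨A, hA, hUA⟩ := U.finGen
    refine ⟨A⁻¹, ?_, by rw [hUA, tightClosure_inv]⟩
    refine (hA.image (fun x => x⁻¹)).subset fun s hs => ⟨s⁻¹, hs, invinv s⟩,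
    U.compat.inv⟩

theorem carrier_mul (U V : TightCompletion S) :
    (U * V).carrier = tightClosure (U.carrier * V.carrier) := rfl

theorem carrier_inv (U : TightCompletion S) : U⁻¹.carrier = U.carrier⁻¹ := rfl

theorem mul_mem {U V : TightCompletion S} {s t : S} (hs : s ∈ U.carrier) (ht : t ∈ V.carrier) :
    s * t ∈ (U * V).carrier := subset_tightClosure _ ⟨s, hs, t, ht, rfl⟩

theorem mul_subset {U V W : TightCompletion S}
    (h : ∀ s ∈ U.carrier, ∀ t ∈ V.carrier, s * t ∈ W.carrier) :
    (U * V).carrier ⊆ W.carrier := by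
  refine closure_subset ?_
  rintro _ ⟨s, hs, t, ht, rfl⟩
  exact h s hs t ht

theorem essIdem_mul_mem {U : TightCompletion S} {n s : S} (hn : n ∈ essIdem S)
    (hs : s ∈ U.carrier) : n * s ∈ U.carrier := by
  rw [← U.closure_eq] at hs ⊢
  exact InvSem.essIdem_mul_mem hn hs

instance : Semigroup (TightCompletion S) where
  mul_assoc U V W := by
    apply ext
    calc tightClosure (tightClosure (U.carrier * V.carrier) * W.carrier)
        = tightClosure (U.carrier * V.carrier * W.carrier) := by
          -- `W` is written as its own closure so that the product formula for closures applies.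
          rw [← W.closure_eq, tightClosure_mul_tightClosure, W.closure_eq]
      _ = tightClosure (U.carrier * (V.carrier * W.carrier)) := by rw [mul_assoc]
      _ = tightClosure (U.carrier * tightClosure (V.carrier * W.carrier)) := by
          rw [← U.closure_eq, tightClosure_mul_tightClosure, U.closure_eq]

theorem inv_inv_eq (U : TightCompletion S) : U⁻¹⁻¹ = U :=
  ext (ProperFilter.set_inv_inv U.carrier)

theorem mul_inv_mul_self (U : TightCompletion S) : U * U⁻¹ * U = U := by
  apply ext
  refine Set.Subset.antisymm ?_ fun s hs => ?_
  · rw [mul_assoc]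
    refine closure_subset ?_
    rintro _ ⟨s, hs, t, ht, rfl⟩
    rw [← U.closure_eq]
    refine tightClosure_subset ?_ (mul_mem_tightClosure (subset_tightClosure {s} rfl) ht)
    rintro _ ⟨s, rfl, _, ⟨v, hv, w, hw, rfl⟩, rfl⟩
    -- Here `v⁻¹ ∈ U`, so `s * v` is an essential idempotent by compatibility and merely restricts
    -- `w`.
    have h := (U.compat s hs _ hv).2
    rw [invinv] at h
    rw [U.closure_eq]
    change s * (v * w) ∈ _
    rw [← mul_assoc]
    exact essIdem_mul_mem h hw
  · have h : s * s⁻¹ * s ∈ (U * U⁻¹ * U).carrier :=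
      mul_mem (mul_mem hs (by rwa [carrier_inv, Set.mem_inv, invinv])) hs
    rwa [mul_assoc s, mul_inv_mul] at h

/-- Write `s = s * s⁻¹ * s` and cover the middle factor by inverses of products `u * v` from `U`.
Then `s * (u * v)⁻¹ * s = (s * v⁻¹) * (u⁻¹ * s)`, and both factors are essential idempotents by
compatibility. -/
theorem subset_essIdem {U : TightCompletion S} (h : U * U = U) : U.carrier ⊆ essIdem S := by
  intro s hs
  have h1 : s ∈ tightClosure (U.carrier * U.carrier) := by rwa [← carrier_mul, h]
  have h2 := mul_mem_tightClosure (mul_mem_tightClosure (subset_tightClosure {s} rfl)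
    (inv_mem_tightClosure h1)) (subset_tightClosure {s} rfl)
  rw [mul_assoc s, mul_inv_mul] at h2
  refine tightClosure_subset ?_ h2
  rintro _ ⟨_, ⟨s, rfl, x, ⟨u, hu, v, hv, hx⟩, rfl⟩, s, rfl, rfl⟩
  have hx' : x = v⁻¹ * u⁻¹ := by rw [← mul_inv_rev']; exact (invinv x).symm.trans (by rw [← hx])
  have := mul_mem_essIdem (U.compat s hs v hv).2 (U.compat u hu s hs).1
  change s * x * s ∈ essIdem S
  rw [hx']
  simpa only [mul_assoc] using this

/-- The covering elements lie below idempotents, so they are genuine idempotents of `S` and commute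
there. -/
theorem mul_subset_mul_comm {U V : TightCompletion S} (hU : U.carrier ⊆ essIdem S)
    (hV : V.carrier ⊆ essIdem S) : (U * V).carrier ⊆ (V * U).carrier := by
  refine mul_subset fun s hs t ht => ?_
  obtain ⟨X, hX, hXE⟩ := hU hs
  obtain ⟨Y, hY, hYE⟩ := hV ht
  refine closure_subset ?_ (mul_mem_tightClosure hX.mem_tightClosure hY.mem_tightClosure)
  rintro _ ⟨x, hx, y, hy, rfl⟩
  obtain ⟨e, he, hxe⟩ := hXE hx
  obtain ⟨f, hf, hyf⟩ := hYE hy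
  change x * y ∈ _
  rw [idem_comm (idem_of_le he hxe) (idem_of_le hf hyf)]
  exact mul_mem (mem_of_le ht (hY.2.1 hy)) (mem_of_le hs (hX.2.1 hx))

theorem idem_mul_comm {U V : TightCompletion S} (hU : U * U = U) (hV : V * V = V) :
    U * V = V * U :=
  ext ((mul_subset_mul_comm (subset_essIdem hU) (subset_essIdem hV)).antisymm
    (mul_subset_mul_comm (subset_essIdem hV) (subset_essIdem hU)))

/-- Generalized inverses are unique if idempotents commute. -/
theorem inverse_unique_of_idem_comm {M : Type u} [Semigroup M]
    (hM : ∀ e f : M, e * e = e → f * f = f → e * f = f * e) {a b c : M} (hab : a * b * a = a)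
    (hba : b * a * b = b) (hac : a * c * a = a) (hca : c * a * c = c) : b = c := by
  have idem_l : ∀ {x y : M}, x * y * x = x → x * y * (x * y) = x * y := fun h => by
    rw [← mul_assoc, h]
  calc b = b * a * (c * a) * b := by rw [mul_assoc b, ← mul_assoc a, hac, hba]
    _ = c * a * (b * a) * b := by rw [hM _ _ (idem_l hba) (idem_l hca)]
    _ = c * a * b := by rw [mul_assoc (c * a), hba]
    _ = c * (a * c) * (a * b) := by rw [← mul_assoc c, hca, mul_assoc]
    _ = c * (a * b * (a * c)) := by rw [mul_assoc, hM _ _ (idem_l hac) (idem_l hab)]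
    _ = c := by rw [← mul_assoc (a * b), hab, ← mul_assoc, hca]

instance : InverseSemigroup (TightCompletion S) where
  mul_inv_mul := mul_inv_mul_self
  inv_mul_inv U := by
    have := mul_inv_mul_self U⁻¹
    rwa [inv_inv_eq] at this
  inv_unique U V h1 h2 := inverse_unique_of_idem_comm (fun _ _ => idem_mul_comm) h1 h2
    (mul_inv_mul_self U) (by have := mul_inv_mul_self U⁻¹; rwa [inv_inv_eq] at this)

/-- Multiplication by the idempotent `U⁻¹ * U` stays inside the closed set `V`. Conversely, if `U`
lies inside `V`, compatibility of `V` makes the elements of `V * U⁻¹` essential idempotents, so `V *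
U⁻¹ * U` falls back into `U`. -/
theorem le_iff {U V : TightCompletion S} : U ≤ V ↔ U.carrier ⊆ V.carrier := by
  rw [le_def]
  constructor
  · intro h
    rw [h]
    refine mul_subset fun s hs t ht => ?_
    rw [← V.closure_eq] at hs ⊢
    exact mul_essIdem_mem hs (subset_essIdem (idem_dom U) ht)
  · intro h
    apply ext
    refine Set.Subset.antisymm ?_ ?_
    · intro s hs
      have : s * (s⁻¹ * s) ∈ (V * (U⁻¹ * U)).carrier :=
        mul_mem (h hs) (mul_mem (by rwa [carrier_inv, Set.mem_inv, invinv]) hs)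
      rwa [mul_inv_mul] at this
    · calc (V * (U⁻¹ * U)).carrier = (V * U⁻¹ * U).carrier := by rw [mul_assoc]
        _ ⊆ U.carrier := by
          refine mul_subset fun s hs t ht => essIdem_mul_mem ?_ ht
          refine tightClosure_subset ?_ hs
          rintro _ ⟨x, hx, y, hy, rfl⟩
          have := (V.compat x hx _ (h hy)).2
          rwa [invinv] at this

/-- The union of the members of a compatible family is essentially compatible. -/
theorem essCompatible_iUnion {X : Set (TightCompletion S)} (hX : IsCompatibleSet X) :
    EssCompatible (⋃ U ∈ X, U.carrier) := by
  intro s hs t ht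
  obtain ⟨U, hU, hs⟩ := Set.mem_iUnion₂.1 hs
  obtain ⟨V, hV, ht⟩ := Set.mem_iUnion₂.1 ht
  obtain ⟨h1, h2⟩ := hX U hU V hV
  exact ⟨subset_essIdem h1 (mul_mem (by rwa [carrier_inv, Set.mem_inv, invinv]) ht),
    subset_essIdem h2 (mul_mem hs (by rwa [carrier_inv, Set.mem_inv, invinv]))⟩

/-- The join of a finite compatible family. -/
theorem exists_join {X : Set (TightCompletion S)} (hfin : X.Finite) (hX : IsCompatibleSet X) :
    ∃ W : TightCompletion S, W.carrier = tightClosure (⋃ U ∈ X, U.carrier) := by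
  choose A hA hUA using fun U : TightCompletion S => U.finGen
  refine ⟨⟨_, ⟨⋃ U ∈ X, A U, hfin.biUnion fun U _ => hA U, ?_⟩,
    (essCompatible_iUnion hX).tightClosure⟩, rfl⟩
  refine (tightClosure_subset ?_).antisymm (tightClosure_mono ?_)
  · refine Set.iUnion₂_subset fun U hU => ?_
    rw [hUA U]
    exact tightClosure_mono (Set.subset_biUnion_of_mem (u := A) hU)
  · refine Set.iUnion₂_mono fun U _ => ?_
    conv_rhs => rw [hUA U]
    exact subset_tightClosure _

theorem isLUB_of_carrier_eq {X : Set (TightCompletion S)} {W : TightCompletion S}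
    (h : W.carrier = tightClosure (⋃ U ∈ X, U.carrier)) : IsLUB X W := by
  constructor
  · intro U hU
    rw [le_iff, h]
    exact (Set.subset_biUnion_of_mem (u := carrier) hU).trans (subset_tightClosure _)
  · intro V hV
    rw [le_iff, h]
    exact closure_subset (Set.iUnion₂_subset fun U hU => le_iff.1 (hV hU))

/-- Compatibility of `X` is automatic, because elements with a common upper bound are compatible. -/
theorem carrier_eq_of_isLUB {X : Set (TightCompletion S)} {W : TightCompletion S}
    (hfin : X.Finite) (h : IsLUB X W) : W.carrier = tightClosure (⋃ U ∈ X, U.carrier) := by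
  obtain ⟨V, hV⟩ := exists_join hfin fun U hU V hV => compatible_of_le (h.1 hU) (h.1 hV)
  rw [h.unique (isLUB_of_carrier_eq hV), hV]

instance : DistributiveInverseSemigroup (TightCompletion S) where
  exists_isLUB X hfin hX := by
    obtain ⟨W, hW⟩ := exists_join hfin hX
    exact ⟨W, isLUB_of_carrier_eq hW⟩
  mul_isLUB X W V hfin hW := by
    constructor
    · rintro _ ⟨U, hU, rfl⟩
      exact mul_le_left V (hW.1 hU)
    · intro Z hZ
      rw [le_iff]
      refine mul_subset fun s hs t ht => ?_
      rw [carrier_eq_of_isLUB hfin hW] at ht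
      refine closure_subset ?_ (mul_mem_tightClosure (subset_tightClosure {s} rfl) ht)
      rintro _ ⟨_, rfl, x, hx, rfl⟩
      obtain ⟨U, hU, hx⟩ := Set.mem_iUnion₂.1 hx
      exact le_iff.1 (hZ ⟨U, hU, rfl⟩) (mul_mem hs hx)
  isLUB_mul X W V hfin hW := by
    constructor
    · rintro _ ⟨U, hU, rfl⟩
      exact mul_le_right (hW.1 hU) V
    · intro Z hZ
      rw [le_iff]
      refine mul_subset fun s hs t ht => ?_
      rw [carrier_eq_of_isLUB hfin hW] at hs
      refine closure_subset ?_ (mul_mem_tightClosure hs (subset_tightClosure {t} rfl))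
      rintro _ ⟨x, hx, _, rfl, rfl⟩
      obtain ⟨U, hU, hx⟩ := Set.mem_iUnion₂.1 hx
      exact le_iff.1 (hZ ⟨U, hU, rfl⟩) (mul_mem hx ht)

end TightCompletion

/-! ### The canonical map, the universal property and meets. -/

namespace TightCompletion

variable {S : Type u} [InverseSemigroup S]

variable (S) in
/-- The canonical map from `S` to its tight completion. -/
def principal : S →ₙ* TightCompletion S where
  toFun s := gen {s} (Set.finite_singleton s) (essCompatible_singleton s)
  map_mul' s t := by
    apply ext
    change tightClosure {s * t} = tightClosure (tightClosure {s} * tightClosure {t})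
    rw [tightClosure_mul_tightClosure, Set.singleton_mul_singleton]

theorem carrier_principal (s : S) : (principal S s).carrier = tightClosure {s} := rfl

theorem mem_principal (s : S) : s ∈ (principal S s).carrier := subset_tightClosure {s} rfl

theorem principal_le_iff {s : S} {U : TightCompletion S} :
    principal S s ≤ U ↔ s ∈ U.carrier := by
  rw [le_iff]
  exact ⟨fun h => h (mem_principal s), fun h => closure_subset (Set.singleton_subset_iff.2 h)⟩

/-- With `A` finite, this reduces morphisms and prime filters on the completion to principal
elements. -/
theorem isLUB_principal_image {U : TightCompletion S} {A : Set S} (h : U.carrier = tightClosure A) :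
    IsLUB (principal S '' A) U := by
  constructor
  · rintro _ ⟨a, ha, rfl⟩
    rw [principal_le_iff, h]
    exact subset_tightClosure A ha
  · intro V hV
    rw [le_iff, h]
    exact closure_subset fun a ha => principal_le_iff.1 (hV ⟨a, ha, rfl⟩)

theorem isTightMap_principal : IsTightMap (principal S) := by
  intro a X hX
  refine isLUB_principal_image ((tightClosure_subset ?_).antisymm (tightClosure_subset ?_))
  · rintro _ rfl
    exact hX.mem_tightClosure
  · exact fun x hx => mem_tightClosure_of_le (mem_principal a) (hX.2.1 hx)

section Lift

variable {T : Type v} [DistributiveInverseSemigroup T] {θ : S →ₙ* T}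

theorem map_idem {θ : S →ₙ* T} {e : S} (he : e * e = e) : θ e * θ e = θ e := by
  rw [← map_mul, he]

theorem map_le {θ : S →ₙ* T} {a b : S} (h : a ≤ b) : θ a ≤ θ b :=
  le_of_eq_mul_idem (map_idem (θ := θ) (idem_dom a)) (by rw [← map_mul, ← le_def.1 h])

theorem map_inv (θ : S →ₙ* T) (a : S) : θ a⁻¹ = (θ a)⁻¹ :=
  eq_inv (by rw [← map_mul, ← map_mul, mul_inv_mul])
    (by rw [← map_mul, ← map_mul, inv_mul_inv])

/-- The image is a finite join of idempotents. This justifies essential compatibility as the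
condition on the completion. -/
theorem map_essIdem (hθ : IsTightMap θ) {n : S} (hn : n ∈ essIdem S) :
    θ n * θ n = θ n := by
  obtain ⟨X, hX, hXE⟩ := hn
  refine idem_of_isLUB (hX.1.image θ) ?_ (hθ n X hX)
  rintro _ ⟨x, hx, rfl⟩
  obtain ⟨e, he, hxe⟩ := hXE hx
  exact map_idem (idem_of_le he hxe)

theorem isCompatibleSet_image (hθ : IsTightMap θ) {A : Set S} (hA : EssCompatible A) :
    IsCompatibleSet (θ '' A) := by
  rintro _ ⟨s, hs, rfl⟩ _ ⟨t, ht, rfl⟩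
  have := hA s hs t ht
  constructor
  · rw [← map_inv, ← map_mul]
    exact map_essIdem hθ this.1
  · rw [← map_inv, ← map_mul]
    exact map_essIdem hθ this.2

/-- A tight map sends each element of the closure to a join of values lying below values on `A`.
Joins over possibly infinite closed sets thus become joins over finite generating sets. -/
theorem upperBounds_image_tightClosure (hθ : IsTightMap θ) (A : Set S) :
    upperBounds (θ '' tightClosure A) = upperBounds (θ '' A) := by
  refine (upperBounds_mono_set (Set.image_mono (subset_tightClosure A))).antisymm ?_
  rintro w hw _ ⟨s, ⟨X, hX, hXA⟩, rfl⟩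
  refine (hθ s X hX).2 ?_
  rintro _ ⟨x, hx, rfl⟩
  obtain ⟨a, ha, hxa⟩ := hXA hx
  exact (map_le hxa).trans (hw ⟨a, ha, rfl⟩)

theorem isLUB_image_tightClosure (hθ : IsTightMap θ) {A : Set S} {c : T} :
    IsLUB (θ '' tightClosure A) c ↔ IsLUB (θ '' A) c := by
  rw [IsLUB, IsLUB, upperBounds_image_tightClosure hθ]

theorem exists_isLUB_image (hθ : IsTightMap θ) (U : TightCompletion S) :
    ∃ c, IsLUB (θ '' U.carrier) c := by
  obtain ⟨A, hA, hUA⟩ := U.finGen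
  obtain ⟨c, hc⟩ := DistributiveInverseSemigroup.exists_isLUB _ (hA.image θ)
    (isCompatibleSet_image hθ (U.compat.mono (hUA ▸ subset_tightClosure A)))
  exact ⟨c, by rwa [hUA, isLUB_image_tightClosure hθ]⟩

/-- The extension of a tight map to the tight completion. -/
theorem exists_lift (hθ : IsTightMap θ) :
    ∃ φ : TightCompletion S →ₙ* T, ∀ U, IsLUB (θ '' U.carrier) (φ U) := by
  choose f hf using exists_isLUB_image hθ
  refine ⟨⟨f, fun U V => ?_⟩, hf⟩
  obtain ⟨A, hA, hUA⟩ := U.finGen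
  obtain ⟨B, hB, hVB⟩ := V.finGen
  have h1 := hf U
  have h2 := hf V
  have h3 := hf (U * V)
  -- All three joins are moved to finite generating sets, where distributivity is available.
  rw [carrier_mul, hUA, hVB, tightClosure_mul_tightClosure, isLUB_image_tightClosure hθ,
    Set.image_mul] at h3
  rw [hUA, isLUB_image_tightClosure hθ] at h1
  rw [hVB, isLUB_image_tightClosure hθ] at h2
  exact h3.unique (isLUB_mul_mul (hA.image θ) (hB.image θ) h1 h2)

theorem existsUnique_lift (hθ : IsTightMap θ) :
    ∃! φ : TightCompletion S →ₙ* T,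
      IsDistributiveMorphism φ ∧ φ.comp (principal S) = θ := by
  obtain ⟨φ, hφ⟩ := exists_lift hθ
  refine ⟨φ, ⟨?_, ?_⟩, ?_⟩
  · intro X W hfin _ hW
    constructor
    · rintro _ ⟨U, hU, rfl⟩
      exact map_le (hW.1 hU)
    · intro w hw
      refine (hφ W).2 ?_
      rw [carrier_eq_of_isLUB hfin hW, upperBounds_image_tightClosure hθ]
      rintro _ ⟨s, hs, rfl⟩
      obtain ⟨U, hU, hs⟩ := Set.mem_iUnion₂.1 hs
      exact ((hφ U).1 ⟨s, hs, rfl⟩).trans (hw ⟨U, hU, rfl⟩)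
  · ext s
    have h := hφ (principal S s)
    rw [carrier_principal, isLUB_image_tightClosure hθ, Set.image_singleton] at h
    exact h.unique isLUB_singleton
  -- Uniqueness: `U` is the join of finitely many principal elements, which are compatible because
  -- `U` bounds them, so `ψ` must preserve this join.
  · rintro ψ ⟨hψ, rfl⟩
    ext U
    obtain ⟨A, hA, hUA⟩ := U.finGen
    have h1 := isLUB_principal_image hUA
    have h2 := hψ _ U (hA.image _)
      (fun V hV W hW => compatible_of_le (h1.1 hV) (h1.1 hW)) h1
    have h3 := hφ U
    rw [hUA, isLUB_image_tightClosure hθ] at h3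
    rw [Set.image_image] at h2
    exact h2.unique h3

end Lift

/-- The weak meet condition makes the tight completion an inverse meet-semigroup. -/
theorem isInverseMeetSemigroup (h : WeakMeetCondition S) :
    IsInverseMeetSemigroup (TightCompletion S) := by
  choose F hF hFeq using h
  have hmem : ∀ {a b z : S}, z ≤ a → z ≤ b → ∃ f ∈ F a b, z ≤ f := fun {a b z} ha hb => by
    have : z ∈ Set.Iic a ∩ Set.Iic b := ⟨ha, hb⟩
    rw [hFeq] at this
    exact this
  have hle : ∀ {a b f : S}, f ∈ F a b → f ≤ a ∧ f ≤ b := fun {a b f} hf => by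
    have : f ∈ (lowerClosure (F a b) : Set S) := subset_lowerClosure hf
    rw [← hFeq] at this
    exact this
  intro U V
  obtain ⟨A, hA, hUA⟩ := U.finGen
  obtain ⟨B, hB, hVB⟩ := V.finGen
  -- As the order is inclusion, the intersection is the only candidate for the meet; what needs
  -- proof is its finite generation.
  have hgen : U.carrier ∩ V.carrier = tightClosure (⋃ a ∈ A, ⋃ b ∈ B, F a b) := by
    refine Set.Subset.antisymm ?_ (Set.subset_inter ?_ ?_)
    · rintro s ⟨hsU, hsV⟩
      rw [hUA] at hsU
      rw [hVB] at hsV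
      obtain ⟨X, hX, hXA⟩ := hsU
      obtain ⟨Y, hY, hYB⟩ := hsV
      refine ⟨⋃ x ∈ X, ⋃ y ∈ Y, F x y, ⟨hX.1.biUnion fun x _ => hY.1.biUnion fun y _ => hF x y,
        ?_, ?_⟩, ?_⟩
      · refine Set.iUnion₂_subset fun x hx => Set.iUnion₂_subset fun y _ f hf => ?_
        exact (hle hf).1.trans (Set.mem_Iic.1 (hX.2.1 hx))
      · intro z hz hz0
        -- The two covers are used in succession: `p` lies below `z` and `x`, then `q` below `p` and
        -- `y`, so `q` lies below some generator in `F x y`.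
        obtain ⟨x, hx, p, hp0, hpz, hpx⟩ := hX.2.2 z hz hz0
        obtain ⟨y, hy, q, hq0, hqp, hqy⟩ := hY.2.2 p (hpz.trans hz) hp0
        obtain ⟨f, hf, hqf⟩ := hmem (hqp.trans hpx) hqy
        exact ⟨f, Set.mem_biUnion hx (Set.mem_biUnion hy hf), q, hq0, hqp.trans hpz, hqf⟩
      · refine Set.iUnion₂_subset fun x hx => Set.iUnion₂_subset fun y hy f hf => ?_
        obtain ⟨a, ha, hxa⟩ := hXA hx
        obtain ⟨b, hb, hyb⟩ := hYB hy
        obtain ⟨g, hg, hfg⟩ := hmem ((hle hf).1.trans hxa) ((hle hf).2.trans hyb)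
        exact ⟨g, Set.mem_biUnion ha (Set.mem_biUnion hb hg), hfg⟩
    · refine closure_subset (Set.iUnion₂_subset fun a ha => Set.iUnion₂_subset fun b _ f hf => ?_)
      refine mem_of_le ?_ (hle hf).1
      rw [hUA]
      exact subset_tightClosure A ha
    · refine closure_subset (Set.iUnion₂_subset fun a _ => Set.iUnion₂_subset fun b hb f hf => ?_)
      refine mem_of_le ?_ (hle hf).2
      rw [hVB]
      exact subset_tightClosure B hb
  refine ⟨⟨U.carrier ∩ V.carrier, ⟨_, hA.biUnion fun a _ => hB.biUnion fun b _ => hF a b, hgen⟩,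
    U.compat.mono Set.inter_subset_left⟩, ?_, ?_⟩
  · rintro _ (rfl | rfl)
    · exact le_iff.2 Set.inter_subset_left
    · exact le_iff.2 Set.inter_subset_right
  · intro W hW
    exact le_iff.2 (Set.subset_inter (le_iff.1 (hW (Or.inl rfl))) (le_iff.1 (hW (Or.inr rfl))))

end TightCompletion

/-! ### Groupoids of filters are étale -/

namespace ProperFilter

variable {S : Type u} [InverseSemigroup S]

/-- The filter `(b E)↑`. -/
def translate (E : ProperFilter S) (b : S) (hb : b⁻¹ * b ∈ E.carrier) : ProperFilter S where
  carrier := {x | b⁻¹ * x ∈ E.carrier}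
  nonempty := ⟨b, hb⟩
  directed x hx y hy := by
    obtain ⟨c, hc, hcx, hcy⟩ := E.directed _ hx _ hy
    -- Below `b⁻¹ * b`, left multiplication by `b` is undone by `b⁻¹`.
    obtain ⟨e, he, hec, heb⟩ := E.directed _ hc _ hb
    refine ⟨b * e, ?_, (mul_le_left b (hec.trans hcx)).trans (cod_mul_le b x),
      (mul_le_left b (hec.trans hcy)).trans (cod_mul_le b y)⟩
    have := cod_mul_of_le heb
    rw [invinv] at this
    rwa [Set.mem_ofPred_eq, this]
  mem_of_le x hx y hxy := E.mem_of_le _ hx _ (mul_le_left _ hxy)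
  proper x hx hbot := E.proper _ hx (isBot_mul hbot _)

theorem mem_dom {F : ProperFilter S} {x : S} :
    x ∈ F.dom ↔ ∃ a ∈ F.carrier, ∃ b ∈ F.carrier, a⁻¹ * b ≤ x := by
  constructor
  · rintro ⟨_, ⟨a, ha, b, hb, rfl⟩, hx⟩
    exact ⟨a⁻¹, ha, b, hb, by rwa [invinv]⟩
  · rintro ⟨a, ha, b, hb, hx⟩
    exact ⟨_, ⟨a⁻¹, by rwa [Set.mem_inv, invinv], b, hb, rfl⟩, hx⟩

/-- In `(b E)⁻¹ (b E) = E⁻¹ b⁻¹ b E` the middle factor disappears, since members of `E` can be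
shrunk below `b⁻¹ * b`. -/
theorem dom_translate {E : ProperFilter S} {b : S} (hb : b⁻¹ * b ∈ E.carrier) :
    (E.translate b hb).dom = E.dom := by
  have key : ∀ {e}, e ≤ b⁻¹ * b → b⁻¹ * (b * e) = e := fun h => by
    have := cod_mul_of_le h
    rwa [invinv] at this
  ext x
  rw [mem_dom, mem_dom]
  constructor
  · rintro ⟨p, hp, q, hq, hx⟩
    refine ⟨_, hp, _, hq, le_trans ?_ hx⟩
    rw [mul_inv_rev', invinv, mul_assoc]
    exact mul_le_left _ (cod_mul_le b q)
  · rintro ⟨p, hp, q, hq, hx⟩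
    obtain ⟨p', hp', hpp, hpb⟩ := E.directed _ hp _ hb
    obtain ⟨q', hq', hqq, hqb⟩ := E.directed _ hq _ hb
    refine ⟨b * p', ?_, b * q', ?_, ?_⟩
    · change b⁻¹ * (b * p') ∈ E.carrier
      rwa [key hpb]
    · change b⁻¹ * (b * q') ∈ E.carrier
      rwa [key hqb]
    · rw [mul_inv_rev', mul_assoc, key hqb]
      exact (mul_le (inv_le hpp) hqq).trans hx

theorem IsTight.translate {E : ProperFilter S} (hE : E.IsTight) {b : S}
    (hb : b⁻¹ * b ∈ E.carrier) : (E.translate b hb).IsTight := by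
  intro a ha X hX
  obtain ⟨_, ⟨x, hx, rfl⟩, hxE⟩ := hE _ ha _ (hX.mul_left b⁻¹)
  exact ⟨x, hx, hxE⟩

theorem IsPrime.translate {D : Type u} [DistributiveInverseSemigroup D] {E : ProperFilter D}
    (hE : E.IsPrime) {b : D} (hb : b⁻¹ * b ∈ E.carrier) : (E.translate b hb).IsPrime := by
  intro p q x hpq hx
  have h := DistributiveInverseSemigroup.mul_isLUB {p, q} x b⁻¹ (Set.toFinite _) hpq
  rw [Set.image_pair] at h
  exact hE _ _ _ h hx

/-- Each `c ≤ a` in `F` equals `a * (c⁻¹ * c)` with `c⁻¹ * c` in the common domain, so `c` belongs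
to `(G d(G))↑ = G`. -/
theorem subset_of_dom_eq {F G : ProperFilter S} {a : S} (ha : a ∈ F.carrier) (ha' : a ∈ G.carrier)
    (h : F.dom = G.dom) : F.carrier ⊆ G.carrier := by
  intro x hx
  obtain ⟨c, hc, hca, hcx⟩ := F.directed a ha x hx
  refine G.mem_of_le c ?_ x hcx
  have h1 : c⁻¹ * c ∈ G.dom := h ▸ mem_dom.2 ⟨c, hc, c, hc, le_rfl⟩
  have h2 : a * (c⁻¹ * c) ∈ up (G.carrier * up (G.carrier⁻¹ * G.carrier)) :=
    ⟨_, ⟨a, ha', _, h1, rfl⟩, le_rfl⟩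
  rwa [mul_up, triple, ← le_def.1 hca] at h2

theorem eq_of_dom_eq {F G : ProperFilter S} {a : S} (ha : a ∈ F.carrier) (ha' : a ∈ G.carrier)
    (h : F.dom = G.dom) : F = G :=
  ext ((subset_of_dom_eq ha ha' h).antisymm (subset_of_dom_eq ha' ha h.symm))

/-- The topology on a set of filters generated by the sets of all filters containing a given
element. -/
@[reducible] def subTopology (p : ProperFilter S → Prop) :
    TopologicalSpace {F : ProperFilter S // p F} :=
  TopologicalSpace.generateFrom (Set.range fun s : S => {F | s ∈ F.1})

theorem isOpen_mem (p : ProperFilter S → Prop) (s : S) :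
    @IsOpen _ (subTopology p) {F : {F : ProperFilter S // p F} | s ∈ F.1.carrier} :=
  TopologicalSpace.isOpen_generateFrom_of_mem ⟨s, rfl⟩

theorem isTopologicalBasis_sub (p : ProperFilter S → Prop) :
    @TopologicalSpace.IsTopologicalBasis _ (subTopology p)
      (Set.range fun s : S => {F : {F : ProperFilter S // p F} | s ∈ F.1}) := by
  let _ := subTopology p
  refine ⟨?_, ?_, rfl⟩
  · rintro _ ⟨s, rfl⟩ _ ⟨t, rfl⟩ F ⟨hs, ht⟩
    obtain ⟨c, hc, hcs, hct⟩ := F.1.directed s hs t ht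
    exact ⟨_, ⟨c, rfl⟩, hc, fun G hG => ⟨G.1.mem_of_le c hG s hcs, G.1.mem_of_le c hG t hct⟩⟩
  · refine Set.eq_univ_of_forall fun F => ?_
    obtain ⟨s, hs⟩ := F.1.nonempty
    exact ⟨_, ⟨s, rfl⟩, hs⟩

/-- A subgroupoid of the groupoid of proper filters is étale if it is closed under the
translations `E ↦ (b E)↑`. -/
theorem isEtaleGroupoid_sub (p : ProperFilter S → Prop)
    (hinv : ∀ x, p x → p (PGroupoid.inv x))
    (hmul : ∀ x y (h : PGroupoid.Comp x y), p x → p y → p (PGroupoid.mul x y h))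
    (htr : ∀ (E : ProperFilter S) (b : S) (hb : b⁻¹ * b ∈ E.carrier), p E → p (E.translate b hb)) :
    @IsEtaleGroupoid {F : ProperFilter S // p F} (subTopology p)
      (PGroupoid.sub p hinv hmul) := by
  let _ := subTopology p
  let _ := PGroupoid.sub p hinv hmul
  have hd : ∀ F : {F : ProperFilter S // p F}, (PGroupoid.d F).1.carrier = F.1.dom := fun _ => rfl
  have hcinv : Continuous (PGroupoid.inv : {F : ProperFilter S // p F} → _) := by
    refine continuous_generateFrom_iff.2 ?_
    rintro _ ⟨s, rfl⟩
    exact isOpen_mem p s⁻¹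
  have hcmul : Continuous
      (fun q : {q : {F : ProperFilter S // p F} × {F : ProperFilter S // p F} //
        PGroupoid.Comp q.1 q.2} => PGroupoid.mul q.1.1 q.1.2 q.2) := by
    refine continuous_generateFrom_iff.2 ?_
    rintro _ ⟨s, rfl⟩
    refine isOpen_iff_mem_nhds.2 ?_
    rintro ⟨⟨F, G⟩, hFG⟩ ⟨_, ⟨a, ha, b, hb, rfl⟩, hs⟩
    have ho : IsOpen ({F : {F : ProperFilter S // p F} | a ∈ F.1.carrier} ×ˢ
        {F : {F : ProperFilter S // p F} | b ∈ F.1.carrier}) :=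
      (isOpen_mem p a).prod (isOpen_mem p b)
    refine Filter.mem_of_superset ((ho.preimage continuous_subtype_val).mem_nhds ⟨ha, hb⟩) ?_
    rintro ⟨⟨F', G'⟩, hFG'⟩ ⟨ha', hb'⟩
    exact ⟨_, ⟨a, ha', b, hb', rfl⟩, hs⟩
  refine ⟨hcinv, hcmul, ?_⟩
  have hcd : Continuous (PGroupoid.d : {F : ProperFilter S // p F} → _) :=
    hcmul.comp (Continuous.subtype_mk (hcinv.prodMk continuous_id) fun F => PGroupoid.inv_comp F)
  have hc : Continuous (Set.rangeFactorization (PGroupoid.d : {F : ProperFilter S // p F} → _)) :=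
    hcd.subtype_mk _
  have hopen : IsOpenMap
      (Set.rangeFactorization (PGroupoid.d : {F : ProperFilter S // p F} → _)) := by
    rw [(isTopologicalBasis_sub p).isOpenMap_iff]
    rintro _ ⟨b, rfl⟩
    -- The image of the filters containing `b` is the set of identities containing `b⁻¹ * b`; a
    -- preimage of such an identity is its translate by `b`.
    convert (isOpen_mem p (b⁻¹ * b)).preimage continuous_subtype_val using 1
    ext ⟨E, G, rfl⟩
    constructor
    · rintro ⟨F, hF, hFE⟩
      have hFE' : PGroupoid.d F = PGroupoid.d G := congrArg Subtype.val hFE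
      change b⁻¹ * b ∈ (PGroupoid.d G).1.carrier
      rw [← hFE', hd]
      exact mem_dom.2 ⟨b, hF, b, hF, le_rfl⟩
    · intro hb
      refine ⟨⟨(PGroupoid.d G).1.translate b hb, htr _ b hb (PGroupoid.d G).2⟩, hb, ?_⟩
      refine Subtype.ext (Subtype.ext (ext ?_))
      change ((PGroupoid.d G).1.translate b hb).dom = G.1.dom
      rw [dom_translate]
      exact dom_mul (dom_inv G.1)
  refine isLocalHomeomorph_iff_isOpenEmbedding_restrict.2 fun F => ?_
  obtain ⟨a, ha⟩ := F.1.nonempty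
  -- On the filters that contain `a`, the domain map is injective by `eq_of_dom_eq`.
  refine ⟨_, (isOpen_mem p a).mem_nhds ha, .of_continuous_injective_isOpenMap
    (hc.comp continuous_subtype_val) ?_ (hopen.comp (isOpen_mem p a).isOpenMap_subtype_val)⟩
  rintro ⟨G, hG⟩ ⟨H, hH⟩ hGH
  refine Subtype.ext (Subtype.ext (eq_of_dom_eq hG hH ?_))
  have : PGroupoid.d G = PGroupoid.d H := congrArg Subtype.val hGH
  rw [← hd, this, hd]

end ProperFilter

theorem isEtaleGroupoid_tightFilter (S : Type u) [InverseSemigroup S] :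
    IsEtaleGroupoid (TightFilter S) :=
  ProperFilter.isEtaleGroupoid_sub ProperFilter.IsTight (fun _ h => h.inv)
    (fun _ _ h _ hG => hG.mul h) fun _ _ hb h => h.translate hb

theorem isEtaleGroupoid_primeFilter (D : Type u) [DistributiveInverseSemigroup D] :
    IsEtaleGroupoid (PrimeFilter D) :=
  ProperFilter.isEtaleGroupoid_sub ProperFilter.IsPrime (fun _ h => h.inv)
    (fun _ _ h _ hG => hG.mul h) fun _ _ hb h => h.translate hb

/-! ### Tight filters of `S` and prime filters of its tight completion -/

/-- A prime filter that contains a finite join contains one of its members. -/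
theorem ProperFilter.IsPrime.exists_mem {D : Type u} [DistributiveInverseSemigroup D]
    {P : ProperFilter D} (hP : P.IsPrime) {X : Set D} (hfin : X.Finite) {c : D} (hc : IsLUB X c)
    (hcP : c ∈ P.carrier) : ∃ x ∈ X, x ∈ P.carrier := by
  induction X, hfin using Set.Finite.induction_on generalizing c with
  | empty => exact absurd (isLUB_empty_iff.1 hc) (P.proper c hcP)
  | @insert a X _ hfin ih =>
    -- The remaining elements are bounded by `c`, hence compatible, so their join `d` exists and `c
    -- = a ∨ d`.
    obtain ⟨d, hd⟩ := DistributiveInverseSemigroup.exists_isLUB X hfin fun s hs t ht =>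
      compatible_of_le (hc.1 (Set.mem_insert_of_mem a hs)) (hc.1 (Set.mem_insert_of_mem a ht))
    have h : IsLUB {a, d} c := by
      have hub : upperBounds (insert a X) = upperBounds {a, d} := by
        rw [upperBounds_insert, upperBounds_insert, hd.upperBounds_eq, upperBounds_singleton]
      rw [IsLUB, ← hub]
      exact hc
    rcases hP a d c h hcP with h | h
    · exact ⟨a, Set.mem_insert a X, h⟩
    · obtain ⟨x, hx, hxP⟩ := ih hd h
      exact ⟨x, Set.mem_insert_of_mem a hx, hxP⟩

namespace TightCompletion

variable {S : Type u} [InverseSemigroup S]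

theorem exists_mem_of_tightClosure {F : ProperFilter S} (hF : F.IsTight) {A : Set S} {s : S}
    (hs : s ∈ tightClosure A) (hsF : s ∈ F.carrier) : ∃ a ∈ A, a ∈ F.carrier := by
  obtain ⟨X, hX, hXA⟩ := hs
  obtain ⟨x, hx, hxF⟩ := hF s hsF X hX
  obtain ⟨a, ha, hxa⟩ := hXA hx
  exact ⟨a, ha, F.mem_of_le x hxF a hxa⟩

theorem carrier_of_isBot {U : TightCompletion S} (hU : IsBot U) :
    U.carrier = tightClosure ∅ := by
  have := carrier_eq_of_isLUB Set.finite_empty (isLUB_empty_iff.2 hU)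
  simpa using this

/-- A zero of `S` is tightly covered by the empty set, whose join is the zero of the completion. -/
theorem isBot_principal {s : S} (hs : IsBot s) : IsBot (principal S s) := by
  have h : TightCover s ∅ :=
    ⟨Set.finite_empty, Set.empty_subset _, fun x hx hx0 => absurd (isBot_of_le hs hx) hx0⟩
  have := isTightMap_principal s ∅ h
  rwa [Set.image_empty, isLUB_empty_iff] at this

theorem exists_principal_mem {P : ProperFilter (TightCompletion S)} (hP : P.IsPrime) {A : Set S}
    (hA : A.Finite) {U : TightCompletion S} (hU : U.carrier = tightClosure A)
    (hUP : U ∈ P.carrier) : ∃ a ∈ A, principal S a ∈ P.carrier := by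
  obtain ⟨_, ⟨a, ha, rfl⟩, haP⟩ := hP.exists_mem (hA.image _) (isLUB_principal_image hU) hUP
  exact ⟨a, ha, haP⟩

/-- The order on principal elements need not reflect the order of `S`: `a` is only tightly covered
by elements below `t`. Primeness selects one of these. -/
theorem exists_le_principal_mem {P : ProperFilter (TightCompletion S)} (hP : P.IsPrime) {a t : S}
    (ha : principal S a ∈ P.carrier) (hat : a ∈ (principal S t).carrier) :
    ∃ x, x ≤ a ∧ x ≤ t ∧ principal S x ∈ P.carrier := by
  obtain ⟨X, hX, hXt⟩ := hat
  obtain ⟨_, ⟨x, hx, rfl⟩, hxP⟩ := hP.exists_mem (hX.1.image _) (isTightMap_principal a X hX) ha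
  obtain ⟨_, rfl, hxt⟩ := hXt hx
  exact ⟨x, hX.2.1 hx, hxt, hxP⟩

/-- The elements of the tight completion that meet a given set. -/
def meeting (Y : Set S) : Set (TightCompletion S) := {U | ∃ s ∈ U.carrier, s ∈ Y}

/-- The prime filter generated by a tight filter. -/
def toPrimeFilter (F : TightFilter S) : PrimeFilter (TightCompletion S) :=
  ⟨{ carrier := meeting F.1.carrier
     nonempty := by
       obtain ⟨s, hs⟩ := F.1.nonempty
       exact ⟨principal S s, s, mem_principal s, hs⟩
     directed := by
       rintro U ⟨s, hsU, hs⟩ V ⟨t, htV, ht⟩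
       obtain ⟨c, hc, hcs, hct⟩ := F.1.directed s hs t ht
       exact ⟨principal S c, ⟨c, mem_principal c, hc⟩, principal_le_iff.2 (mem_of_le hsU hcs),
         principal_le_iff.2 (mem_of_le htV hct)⟩
     mem_of_le := fun _ ⟨s, hsU, hs⟩ _ hUV => ⟨s, le_iff.1 hUV hsU, hs⟩
     proper := by
       rintro U ⟨s, hsU, hs⟩ hU
       rw [carrier_of_isBot hU] at hsU
       obtain ⟨_, h, _⟩ := exists_mem_of_tightClosure F.2 hsU hs
       exact h }, by
    rintro U V W hW ⟨s, hsW, hs⟩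
    rw [carrier_eq_of_isLUB (Set.toFinite _) hW] at hsW
    obtain ⟨a, ha, haF⟩ := exists_mem_of_tightClosure F.2 hsW hs
    obtain ⟨Z, rfl | rfl, haZ⟩ := Set.mem_iUnion₂.1 ha
    · exact Or.inl ⟨a, haZ, haF⟩
    · exact Or.inr ⟨a, haZ, haF⟩⟩

/-- The tight filter that is the preimage of a prime filter. -/
def toTightFilter (P : PrimeFilter (TightCompletion S)) : TightFilter S :=
  ⟨{ carrier := {s | principal S s ∈ P.1.carrier}
     nonempty := by
       obtain ⟨U, hU⟩ := P.1.nonempty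
       obtain ⟨A, hA, hUA⟩ := U.finGen
       obtain ⟨a, -, ha⟩ := exists_principal_mem P.2 hA hUA hU
       exact ⟨a, ha⟩
     directed := by
       intro s hs t ht
       -- The lower bound `U` need not be principal. It is replaced by a generator, which is then
       -- shrunk below `s` and afterwards below `t`.
       obtain ⟨U, hU, hUs, hUt⟩ := P.1.directed _ hs _ ht
       obtain ⟨A, hA, hUA⟩ := U.finGen
       obtain ⟨a, haA, ha⟩ := exists_principal_mem P.2 hA hUA hU
       have haU : a ∈ U.carrier := hUA ▸ subset_tightClosure A haA
       obtain ⟨x, hxa, hxs, hx⟩ := exists_le_principal_mem P.2 ha (le_iff.1 hUs haU)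
       obtain ⟨y, hyx, hyt, hy⟩ :=
         exists_le_principal_mem P.2 hx (mem_of_le (le_iff.1 hUt haU) hxa)
       exact ⟨y, hy, hyx.trans hxs, hyt⟩
     mem_of_le := fun _ hs _ hst => P.1.mem_of_le _ hs _ (map_le hst)
     proper := fun _ hs hbot => P.1.proper _ hs (isBot_principal hbot) }, by
    intro a ha X hX
    obtain ⟨_, ⟨x, hx, rfl⟩, hxP⟩ :=
      P.2.exists_mem (hX.1.image _) (isTightMap_principal a X hX) ha
    exact ⟨x, hx, hxP⟩⟩

theorem principal_mem_meeting {F : ProperFilter S} (hF : F.IsTight) {s : S} :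
    principal S s ∈ meeting F.carrier ↔ s ∈ F.carrier := by
  constructor
  · rintro ⟨t, ht, htF⟩
    obtain ⟨_, rfl, h⟩ := exists_mem_of_tightClosure hF ht htF
    exact h
  · exact fun h => ⟨s, mem_principal s, h⟩

theorem toTightFilter_toPrimeFilter (F : TightFilter S) : toTightFilter (toPrimeFilter F) = F :=
  Subtype.ext (ProperFilter.ext (Set.ext fun _ => principal_mem_meeting F.2))

theorem toPrimeFilter_toTightFilter (P : PrimeFilter (TightCompletion S)) :
    toPrimeFilter (toTightFilter P) = P := by
  refine Subtype.ext (ProperFilter.ext (Set.ext fun U => ⟨?_, fun hU => ?_⟩))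
  · rintro ⟨s, hsU, hs⟩
    exact P.1.mem_of_le _ hs U (principal_le_iff.2 hsU)
  · obtain ⟨A, hA, hUA⟩ := U.finGen
    obtain ⟨a, haA, ha⟩ := exists_principal_mem P.2 hA hUA hU
    exact ⟨a, hUA ▸ subset_tightClosure A haA, ha⟩

/-- Stated for arbitrary sets, so that it yields domains, ranges and products of filters alike. -/
theorem up_meeting_mul (X Y : Set S) : up (meeting X * meeting Y) = meeting (up (X * Y)) := by
  ext W
  constructor
  · rintro ⟨_, ⟨U, ⟨s, hsU, hs⟩, V, ⟨t, htV, ht⟩, rfl⟩, hW⟩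
    exact ⟨s * t, le_iff.1 hW (mul_mem hsU htV), _, ⟨s, hs, t, ht, rfl⟩, le_rfl⟩
  · rintro ⟨w, hwW, _, ⟨s, hs, t, ht, rfl⟩, hw⟩
    refine ⟨_, ⟨principal S s, ⟨s, mem_principal s, hs⟩, principal S t, ⟨t, mem_principal t, ht⟩,
      rfl⟩, ?_⟩
    change principal S s * principal S t ≤ W
    rw [← map_mul, principal_le_iff]
    exact mem_of_le hwW hw

theorem meeting_inv (X : Set S) : (meeting X)⁻¹ = meeting X⁻¹ := by
  ext U
  constructor
  · rintro ⟨s, hsU, hs⟩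
    exact ⟨s⁻¹, hsU, by rwa [Set.mem_inv, invinv]⟩
  · rintro ⟨s, hsU, hs⟩
    exact ⟨s⁻¹, by rwa [carrier_inv, Set.mem_inv, invinv], hs⟩

theorem dom_toPrimeFilter (F : TightFilter S) : (toPrimeFilter F).1.dom = meeting F.1.dom := by
  change up ((meeting F.1.carrier)⁻¹ * meeting F.1.carrier) = _
  rw [meeting_inv, up_meeting_mul]
  rfl

theorem cod_toPrimeFilter (F : TightFilter S) : (toPrimeFilter F).1.cod = meeting F.1.cod := by
  change up (meeting F.1.carrier * (meeting F.1.carrier)⁻¹) = _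
  rw [meeting_inv, up_meeting_mul]
  rfl

theorem meeting_injective {E F : ProperFilter S} (hE : E.IsTight) (hF : F.IsTight)
    (h : meeting E.carrier = meeting F.carrier) : E.carrier = F.carrier := by
  ext s
  rw [← principal_mem_meeting hE, h, principal_mem_meeting hF]

theorem comp_toPrimeFilter_iff (F G : TightFilter S) :
    PGroupoid.Comp (toPrimeFilter F) (toPrimeFilter G) ↔ PGroupoid.Comp F G := by
  change (toPrimeFilter F).1.dom = (toPrimeFilter G).1.cod ↔ F.1.dom = G.1.cod
  rw [dom_toPrimeFilter, cod_toPrimeFilter]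
  refine ⟨fun h => ?_, fun h => by rw [h]⟩
  -- `d(F)` and `r(G)` are themselves tight filters, namely the products `F⁻¹ · F` and `G · G⁻¹`.
  exact meeting_injective (ProperFilter.IsTight.mul F.2 (ProperFilter.dom_inv F.1))
    (ProperFilter.IsTight.mul G.2.inv (ProperFilter.cod_inv G.1).symm) h

variable (S) in
/-- The groupoid of tight filters of `S` is homeomorphic to the groupoid of prime filters of the
tight completion. -/
def groupoidHomeomorph : GroupoidHomeomorph (TightFilter S) (PrimeFilter (TightCompletion S)) where
  toFun := toPrimeFilter
  invFun := toTightFilter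
  left_inv := toTightFilter_toPrimeFilter
  right_inv := toPrimeFilter_toTightFilter
  continuous_toFun := by
    refine continuous_generateFrom_iff.2 ?_
    rintro _ ⟨U, rfl⟩
    have h : toPrimeFilter ⁻¹' {P : PrimeFilter (TightCompletion S) | U ∈ P.1} =
        ⋃ s ∈ U.carrier, {F : TightFilter S | s ∈ F.1} := by
      ext F
      rw [Set.mem_iUnion₂]
      exact ⟨fun ⟨s, hs, h⟩ => ⟨s, hs, h⟩, fun ⟨s, hs, h⟩ => ⟨s, hs, h⟩⟩
    rw [h]
    exact isOpen_biUnion fun s _ => TopologicalSpace.isOpen_generateFrom_of_mem ⟨s, rfl⟩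
  continuous_invFun := by
    refine continuous_generateFrom_iff.2 ?_
    rintro _ ⟨s, rfl⟩
    exact TopologicalSpace.isOpen_generateFrom_of_mem ⟨principal S s, rfl⟩
  comp_iff := comp_toPrimeFilter_iff
  map_mul F G _ := Subtype.ext (ProperFilter.ext (up_meeting_mul F.1.carrier G.1.carrier).symm)

end TightCompletion

end InvSem

theorem theorem4p30 (S : Type u) [InvSem.InverseSemigroup S] :
    ∃ (D : Type u) (_ : InvSem.DistributiveInverseSemigroup D) (δ : S →ₙ* D),
      (InvSem.IsTightMap δ ∧
        ∀ (T : Type (max u v)) [InvSem.DistributiveInverseSemigroup T] (θ : S →ₙ* T),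
          InvSem.IsTightMap θ →
            ∃! φ : D →ₙ* T, InvSem.IsDistributiveMorphism φ ∧ φ.comp δ = θ) ∧
      (InvSem.IsEtaleGroupoid (InvSem.TightFilter S) ∧
        InvSem.IsEtaleGroupoid (InvSem.PrimeFilter D) ∧
        Nonempty (InvSem.GroupoidHomeomorph (InvSem.TightFilter S) (InvSem.PrimeFilter D))) ∧
      (InvSem.WeakMeetCondition S → InvSem.IsInverseMeetSemigroup D) :=
  ⟨InvSem.TightCompletion S, inferInstance, InvSem.TightCompletion.principal S,
    ⟨InvSem.TightCompletion.isTightMap_principal,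
      fun _ _ _ hθ => InvSem.TightCompletion.existsUnique_lift hθ⟩,
    ⟨InvSem.isEtaleGroupoid_tightFilter S, InvSem.isEtaleGroupoid_primeFilter _,
      ⟨InvSem.TightCompletion.groupoidHomeomorph S⟩⟩,
    InvSem.TightCompletion.isInverseMeetSemigroup⟩
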